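/- **Lower bound, strongly monotone case.** Consider, for $r>0$, the problems $$\text{(CVX)}\quad \min_{x\in\mathbb R^d}\; p(x)=\frac1n\sum_{i=1}^n f_i(x)+\frac r2\|x\|^2,\qquad \text{(SPP)}\quad \min_{\xi\in\mathbb R^{d_\xi}}\max_{\zeta\in\mathbb R^{d_\zeta}}\; p(\xi,\zeta)=\frac1n\sum_{i=1}^n f_i(\xi,\zeta)+\frac r2\|\xi\|^2-\frac r2\|\zeta\|^2,$$ where the $f_i$ are convex, respectively convex in $\xi$ and concave in $\zeta$. Let $\mathcal H=\mathbb R^d$ and $\mathbf T_i=\partial f_i$ for (CVX), and $\mathcal H=\mathbb R^{d_\xi+d_\zeta}$ and $\mathbf T_i=[\partial_\xi f_i,-\partial_\zeta f_i]$ for (SPP). Let $x^*$, respectively $x^*=(\xi^*,\zeta^*)$, be a minimizer, respectively a saddle point, of $p$, and let the gap be $G(x)=p(x)-p(x^*)$, respectively $G(\xi,\zeta)=p(\xi,\zeta^*)-p(\xi^*,\zeta)$. *Assumptions on an instance, with constants $M,\sigma,\chi$.* (i) $\|g\|\le M$ for all $i$, all $x\in\mathcal H$ and all $g\in\mathbf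 T_i(x)$. (ii) Each node $i$ has a stochastic oracle $\tilde{\mathbf g}_i(x)$ with $\mathbb E\,\tilde{\mathbf g}_i(x)\in\mathbf T_i(x)$ and $\mathbb E\|\tilde{\mathbf g}_i(x)-\mathbb E\,\tilde{\mathbf g}_i(x)\|^2\le\sigma^2$ for all $x$; the randomness is drawn independently for different calls (at one call, the noises of different nodes may be dependent). (iii) The time-varying network has edge sets $\mathcal E(\tau)$ and gossip matrices $\mathbf W(\tau)\in\mathbb R^{n\times n}$, $\tau\ge0$, with $\mathbf W(\tau)_{ij}=0$ if $i\ne j$ and $(j,i)\notin\mathcal E(\tau)$, with $\mathbf W(\tau)\mathbf 1=0=\mathbf W(\tau)^\top\mathbf 1$, and with $\|\mathbf W(\tau)x-x\|^2\le(1-\frac1\chi)\|x\|^2$ whenever $\sum_i x_i=0$. *Algorithm.* Its parameters are $K,T\in\{1,2,\dots\}$, nonnegative sequences $\alpha_k,\beta_k,\gamma_k,\sigma_k,\lambda_k,\tau_x^k,\eta_x^k,\eta_y^k,\eta_z^k,\theta_z^k$, and $r_x,r_{yz}>0$ with $r_x+1/r_{yz}=r$. All variables $x^0=x^{-1}=\tilde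 x^0,\bar x^0,y^0,\bar y^0,z^0,\bar z^0,m^0\in\mathcal H^n$ are $0$. For $k=0,\dots,K-1$, with $\mathbf W_k=\mathbf W(\tau_k)\otimes\mathbf I$, where $\tau_k$ is the time of the $k$-th communication: - $\underline y^k=\alpha_ky^k+(1-\alpha_k)\bar y^k$, $\ \underline z^k=\alpha_kz^k+(1-\alpha_k)\bar z^k$, $\ g_y^k=g_z^k=r_{yz}(\underline y^k+\underline z^k)$; - $\tilde g_z^k=\mathbf W_kg_z^k$, $\ \hat g_z^k=\mathbf W_k(g_z^k+m^k)$ (one decentralized communication); - $\hat x^{k+1}=x^k+\gamma_k(\tilde x^k-x^{k-1})$, $\ y^{k+1}=y^k-\eta_y^k(g_y^k+\hat x^{k+1})$, $\ z^{k+1}=z^k-\eta_z^k\hat g_z^k$; - $\bar y^{k+1}=\underline y^k+\alpha_k(y^{k+1}-y^k)$, $\ \bar z^{k+1}=\underline z^k-\theta_z^k\tilde g_z^k$, $\ m^{k+1}=(\eta_z^k/\eta_z^{k+1})(m^k+g_z^k-\hat g_z^k)$ (with the factor read as $0$ if $\eta_z^{k+1}=0$); - $x^{k,0}=x^k$ and,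 for $t=0,\dots,T-1$, $\ g_x^{k,t}=(\tilde{\mathbf g}_1(x_1^{k,t}),\dots,\tilde{\mathbf g}_n(x_n^{k,t}))$ (one oracle call) and $x^{k,t+1}=x^{k,t}-\eta_x^k\big(g_x^{k,t}+\beta_kx^{k,t+1}-y^{k+1}+\tau_x^k(x^{k,t+1}-x^k)\big)$; - $\tilde x^{k+1}=\frac1T\sum_{t=1}^Tx^{k,t}$, $\ x^{k+1}=\sigma_kx^{k,T}+(1-\sigma_k)\tilde x^{k+1}$, $\ \bar x^{k+1}=\alpha_k\tilde x^{k+1}+(1-\alpha_k)\bar x^k$. The output is $x_o^K=\frac1n\sum_{i=1}^nx_{a,i}^K$, where $x_a^K=(\sum_{k=1}^K\lambda_k)^{-1}\sum_{k=1}^K\lambda_k\bar x^k$ (read as $0$ if $\sum_{k=1}^K\lambda_k=0$). The run makes $K$ decentralized communications and $KT$ oracle calls. *Claim.* There are universal constants $c,c_0>0$ such that for all $r>0$, $M>0$, $\sigma\ge0$, $\chi\ge1$, all $0<\varepsilon\le c_0M^2/r$ and all communication times $0\le\tau_0<\tau_1<\cdots$ the following holds, both for (CVX) and for (SPP): there exist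 a problem (with $n,d,d_\xi,d_\zeta\ge1$) with solution $x^*$, stochastic oracles and a time-varying network satisfying (i)–(iii) with these $M,\sigma,\chi$ such that every run of the algorithm, whatever its parameters, with $\mathbb E[G(x_o^K)]\le\varepsilon$ satisfies $$K\ \ge\ c\,\frac{\chi M}{\sqrt{r\varepsilon}}\qquad\text{and}\qquad KT\ \ge\ c\,\frac{(M+\sigma)^2}{r\varepsilon}.$$ -/

import Mathlib

open MeasureTheory ProbabilityTheory
open scoped NNReal

namespace Decentralized

noncomputable section

/-! ## Optimization problems -/

/-- The subdifferential at `x` of a function `f` on a real inner product space. -/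
def subdiff {E : Type*} [NormedAddCommGroup E] [InnerProductSpace ℝ E] (f : E → ℝ) (x : E) :
    Set E :=
  {g | ∀ y, f x + inner ℝ g (y - x) ≤ f y}

/-- Data of the minimization problem
`min_x p(x) = (1/n) ∑ i, f i x + (r/2) ‖x‖²` over `ℝ^d`, with every `f i` convex. -/
structure ConvexProblem (n d : ℕ) where
  f : Fin n → EuclideanSpace ℝ (Fin d) → ℝ
  convex : ∀ i, ConvexOn ℝ Set.univ (f i)

namespace ConvexProblem

variable {n d : ℕ} (P : ConvexProblem n d)

/-- The objective `p`. -/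
def objective (r : ℝ) (x : EuclideanSpace ℝ (Fin d)) : ℝ :=
  1 / n * ∑ i, P.f i x + r / 2 * ‖x‖ ^ 2

/-- The operator `T_i(x) = ∂ f_i(x)`. -/
def operator (i : Fin n) (x : EuclideanSpace ℝ (Fin d)) : Set (EuclideanSpace ℝ (Fin d)) :=
  subdiff (P.f i) x

/-- `xs` is a minimizer of `p`. -/
def IsSolution (r : ℝ) (xs : EuclideanSpace ℝ (Fin d)) : Prop :=
  ∀ x, P.objective r xs ≤ P.objective r x

/-- The gap `p(x) - p(xs)`, where `xs` is a solution. -/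
def gap (r : ℝ) (xs x : EuclideanSpace ℝ (Fin d)) : ℝ :=
  P.objective r x - P.objective r xs

end ConvexProblem

/-- The space `ℝ^{d₁ + d₂}` of pairs `(ξ, ζ)`, with the Euclidean norm. -/
abbrev PairSpace (d₁ d₂ : ℕ) : Type :=
  WithLp 2 (EuclideanSpace ℝ (Fin d₁) × EuclideanSpace ℝ (Fin d₂))

/-- Data of the saddle point problem
`min_ξ max_ζ p(ξ, ζ) = (1/n) ∑ i, f i ξ ζ + (r/2) ‖ξ‖² - (r/2) ‖ζ‖²`,
with every `f i` convex in `ξ` and concave in `ζ`. -/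
structure SaddleProblem (n d₁ d₂ : ℕ) where
  f : Fin n → EuclideanSpace ℝ (Fin d₁) → EuclideanSpace ℝ (Fin d₂) → ℝ
  convex : ∀ i ζ, ConvexOn ℝ Set.univ (fun ξ => f i ξ ζ)
  concave : ∀ i ξ, ConcaveOn ℝ Set.univ (fun ζ => f i ξ ζ)

namespace SaddleProblem

variable {n d₁ d₂ : ℕ} (P : SaddleProblem n d₁ d₂)

/-- The objective `p`. -/
def objective (r : ℝ) (ξ : EuclideanSpace ℝ (Fin d₁)) (ζ : EuclideanSpace ℝ (Fin d₂)) : ℝ :=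
  1 / n * ∑ i, P.f i ξ ζ + r / 2 * ‖ξ‖ ^ 2 - r / 2 * ‖ζ‖ ^ 2

/-- The operator `T_i(ξ, ζ) = [∂_ξ f_i(ξ, ζ), -∂_ζ f_i(ξ, ζ)]`. As `f_i(ξ, ·)` is concave, the
second component is the subdifferential of the convex function `-f_i(ξ, ·)`. -/
def operator (i : Fin n) (x : PairSpace d₁ d₂) : Set (PairSpace d₁ d₂) :=
  {g | g.fst ∈ subdiff (fun ξ => P.f i ξ x.snd) x.fst ∧
    g.snd ∈ subdiff (fun ζ => -P.f i x.fst ζ) x.snd}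

/-- `xs = (ξ*, ζ*)` is a saddle point of `p`. -/
def IsSolution (r : ℝ) (xs : PairSpace d₁ d₂) : Prop :=
  ∀ ξ ζ, P.objective r xs.fst ζ ≤ P.objective r xs.fst xs.snd ∧
    P.objective r xs.fst xs.snd ≤ P.objective r ξ xs.snd

/-- The gap `p(ξ, ζ*) - p(ξ*, ζ)` of `x = (ξ, ζ)`, where `xs = (ξ*, ζ*)` is a solution. -/
def gap (r : ℝ) (xs x : PairSpace d₁ d₂) : ℝ :=
  P.objective r x.fst xs.snd - P.objective r xs.fst x.snd

end SaddleProblem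

/-! ## Oracles and networks -/

/-- All values of the operators `T_i` are bounded by `M`. -/
def OperatorBound {n : ℕ} {H : Type*} [NormedAddCommGroup H]
    (T : Fin n → H → Set H) (M : ℝ) : Prop :=
  ∀ i x, ∀ g ∈ T i x, ‖g‖ ≤ M

/-- `g` is a stochastic oracle for the set-valued operator `T`: with `s` distributed according to
`ν`, the mean of `g x s` belongs to `T x`, and its variance is at most `σ²`. -/
structure IsStochasticOracle {H Ξ : Type*} [NormedAddCommGroup H] [InnerProductSpace ℝ H]
    [MeasurableSpace H] [MeasurableSpace Ξ] (T : H → Set H) (ν : Measure Ξ) (σ : ℝ)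
    (g : H → Ξ → H) : Prop where
  measurable : Measurable (Function.uncurry g)
  memLp : ∀ x, MemLp (g x) 2 ν
  mean_mem : ∀ x, ∫ s, g x s ∂ν ∈ T x
  variance_le : ∀ x, ∫ s, ‖g x s - ∫ s', g x s' ∂ν‖ ^ 2 ∂ν ≤ σ ^ 2

/-- A time-varying network on `n` nodes: at each time a set of directed edges, and a gossip matrix
that is supported on the edges and the diagonal and whose rows and columns sum to zero. -/
structure Network (n : ℕ) where
  edges : ℝ≥0 → Set (Fin n × Fin n)
  W : ℝ≥0 → Matrix (Fin n) (Fin n) ℝ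
  supported : ∀ τ i j, i ≠ j → (j, i) ∉ edges τ → W τ i j = 0
  row_sum : ∀ τ i, ∑ j, W τ i j = 0
  col_sum : ∀ τ j, ∑ i, W τ i j = 0

/-- The network has condition number (at most) `χ`: at all times `τ`,
`‖W(τ) x - x‖² ≤ (1 - 1/χ) ‖x‖²` for every `x ∈ ℝ^n` whose coordinates sum to zero. -/
def Network.HasConditionNumber {n : ℕ} (N : Network n) (χ : ℝ) : Prop :=
  ∀ (τ : ℝ≥0) (x : Fin n → ℝ), ∑ i, x i = 0 →
    ∑ i, ((N.W τ).mulVec x i - x i) ^ 2 ≤ (1 - 1 / χ) * ∑ i, x i ^ 2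

/-! ## The algorithm -/

/-- The parameters of the algorithm: nonnegative sequences, and a splitting `r_x + 1 / r_yz = r`
with `r_x, r_yz > 0`. -/
structure Params (r : ℝ) where
  (α β γ σ lam τx ηx ηy ηz θz : ℕ → ℝ≥0)
  rx : ℝ
  ryz : ℝ
  rx_pos : 0 < rx
  ryz_pos : 0 < ryz
  split : rx + 1 / ryz = r

/-- The variables of the algorithm, each one a vector of `H^n`: `x = x^k`, `xPrev = x^{k-1}`,
`xTilde = x̃^k`, `xBar = x̄^k`, `y = y^k`, `yBar = ȳ^k`, `z = z^k`, `zBar = z̄^k`, `m = m^k`. -/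
structure State (n : ℕ) (H : Type*) where
  (x xPrev xTilde xBar y yBar z zBar m : Fin n → H)

section Algorithm

variable {n : ℕ} {H Ξ : Type*} [NormedAddCommGroup H] [InnerProductSpace ℝ H] {r : ℝ}

/-- One decentralized communication: multiplication by `W ⊗ I`. -/
def gossip (W : Matrix (Fin n) (Fin n) ℝ) (v : Fin n → H) : Fin n → H :=
  fun i => ∑ j, W i j • v j

/-- One inner step: the point `x'` with
`x' = x - η (g + β x' - y + τ (x' - xk))`, in solved form (see `innerStep_spec`). -/
def innerStep (η β τ : ℝ) (x g y xk : H) : H :=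
  (1 + η * (β + τ))⁻¹ • (x - η • (g - y - τ • xk))

theorem innerStep_spec {η β τ : ℝ} (hη : 0 ≤ η) (hβ : 0 ≤ β) (hτ : 0 ≤ τ) (x g y xk x' : H) :
    x' = innerStep η β τ x g y xk ↔ x' = x - η • (g + β • x' - y + τ • (x' - xk)) := by
  have h : 1 + η * (β + τ) ≠ 0 := by positivity
  rw [innerStep, eq_inv_smul_iff₀ h, ← sub_eq_zero, ← sub_eq_zero (a := x')]
  have e : (1 + η * (β + τ)) • x' - (x - η • (g - y - τ • xk)) =
      x' - (x - η • (g + β • x' - y + τ • (x' - xk))) := by module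
  rw [e]

/-- The inner loop of iteration `k`, started at `xk`: its `t`-th iterate is `x^{k,t}`. The step from
`t` to `t + 1` calls, at each node `i`, the stochastic oracle `g i` at the node's current point,
with the random sample `s t`. -/
def innerLoop (p : Params r) (g : Fin n → H → Ξ → H) (k : ℕ) (s : ℕ → Ξ) (xk y : Fin n → H) :
    ℕ → Fin n → H
  | 0 => xk
  | t + 1 => fun i =>
      let x := innerLoop p g k s xk y t i
      innerStep (p.ηx k) (p.β k) (p.τx k) x (g i x (s t)) (y i) (xk i)

/-- Iteration `k` of the algorithm, with gossip matrix `W`, `T` inner steps and the random samples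
`s 0, …, s (T - 1)`. Both partial gradients of `G(y, z) = (r_yz / 2) ‖y + z‖²` are
`r_yz (y + z)`. -/
def outerStep (p : Params r) (g : Fin n → H → Ξ → H) (T : ℕ) (W : Matrix (Fin n) (Fin n) ℝ)
    (k : ℕ) (s : ℕ → Ξ) (S : State n H) : State n H :=
  let α : ℝ := p.α k
  let yU := α • S.y + (1 - α) • S.yBar
  let zU := α • S.z + (1 - α) • S.zBar
  let gy := p.ryz • (yU + zU)
  let gz := p.ryz • (yU + zU)
  let gzTilde := gossip W gz
  let gzHat := gossip W (gz + S.m)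
  let xHat := S.x + (p.γ k : ℝ) • (S.xTilde - S.xPrev)
  let y' := S.y - (p.ηy k : ℝ) • (gy + xHat)
  let z' := S.z - (p.ηz k : ℝ) • gzHat
  let u := innerLoop p g k s S.x y'
  let xTilde' := (1 / T : ℝ) • ∑ t ∈ Finset.Icc 1 T, u t
  { x := (p.σ k : ℝ) • u T + (1 - (p.σ k : ℝ)) • xTilde'
    xPrev := S.x
    xTilde := xTilde'
    xBar := α • xTilde' + (1 - α) • S.xBar
    y := y'
    yBar := yU + α • (y' - S.y)
    z := z'
    zBar := zU - (p.θz k : ℝ) • gzTilde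
    m := ((p.ηz k : ℝ) / (p.ηz (k + 1) : ℝ)) • (S.m + gz - gzHat) }

/-- The state before iteration `k`. All variables start at zero. The communication of iteration `k`
uses the gossip matrix `W k`, and inner step `t` of iteration `k` uses the random sample `s k t`. -/
def run (p : Params r) (g : Fin n → H → Ξ → H) (T : ℕ) (W : ℕ → Matrix (Fin n) (Fin n) ℝ)
    (s : ℕ → ℕ → Ξ) : ℕ → State n H
  | 0 => ⟨0, 0, 0, 0, 0, 0, 0, 0, 0⟩
  | k + 1 => outerStep p g T (W k) k (s k) (run p g T W s k)

/-- The output `x_o^K`: the average over the nodes of the weighted average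
`x_a^K = (∑_{k=1}^K λ_k)⁻¹ ∑_{k=1}^K λ_k x̄^k`. -/
def output (p : Params r) (g : Fin n → H → Ξ → H) (K T : ℕ)
    (W : ℕ → Matrix (Fin n) (Fin n) ℝ) (s : ℕ → ℕ → Ξ) : H :=
  let xa : Fin n → H := (∑ k ∈ Finset.Icc 1 K, (p.lam k : ℝ))⁻¹ •
    ∑ k ∈ Finset.Icc 1 K, (p.lam k : ℝ) • (run p g T W s k).xBar
  (1 / n : ℝ) • ∑ i, xa i

/-- Every run of the algorithm (for all choices of its parameters, of the number `K` of outer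
iterations and of the number `T` of inner steps) whose output has expected gap at most `ε` makes at
least `Ncomm` decentralized communications and at least `Noracle` oracle calls. A run with `K` outer
iterations of `T` inner steps makes `K` communications, the `k`-th one at time `commTime k`, and
`K * T` oracle calls, with independent samples of law `ν`. -/
def RequiresAtLeast [MeasurableSpace Ξ] (r : ℝ) (gap : H → ℝ) (N : Network n)
    (commTime : ℕ → ℝ≥0) (ν : Measure Ξ) (g : Fin n → H → Ξ → H) (ε Ncomm Noracle : ℝ) : Prop :=
  ∀ (Ω : Type) [MeasurableSpace Ω] (μ : Measure Ω) [IsProbabilityMeasure μ] (s : ℕ → ℕ → Ω → Ξ),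
    (∀ k t, Measurable (s k t)) → (∀ k t, μ.map (s k t) = ν) →
    iIndepFun (fun kt : ℕ × ℕ => s kt.1 kt.2) μ →
    ∀ (p : Params r) (K T : ℕ), 1 ≤ K → 1 ≤ T →
      Integrable (fun ω => gap (output p g K T (fun k => N.W (commTime k))
        (fun k t => s k t ω))) μ →
      ∫ ω, gap (output p g K T (fun k => N.W (commTime k)) (fun k t => s k t ω)) ∂μ ≤ ε →
      Ncomm ≤ K ∧ Noracle ≤ K * T

end Algorithm

end

end Decentralized

namespace Decentralized

noncomputable section

/-! ## Invariant subspaces of the algorithm -/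

section Invariance

variable {n : ℕ} {H Ξ : Type*} [NormedAddCommGroup H] [InnerProductSpace ℝ H] {r : ℝ}

/-! Apart from oracle answers and gossip, the algorithm only forms linear combinations of vectors a
node already has, so whatever its parameters, each node stays in a subspace that grows only through
these two operations (`run_memIn`, `output_mem`). The hard instance makes this growth slow in two
independent blocks of coordinates.

Communication: the first `N₁` coordinates carry the chain `-x_0 + ∑ |x_e - x_{e+1}|`. Its even links
belong to the nodes of type 0, its odd links to those of type 1, so discovering coordinates in turn
requires alternating between the two types. The only traffic passes through a star whose center
rotates over the `m` nodes of type 2. A center sends what it knew before and forwards what it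
collects only when it is center again, `m` rounds later. After `K` rounds at most `K / m + 1`
coordinates are nonzero (`output_mem_vanishing_chain`), while `m` is of order `χ`.

Oracle: every node holds the maximum of the last `N₂` coordinates. Its subgradient at the first
maximizer reveals at most one new coordinate, and a coin common to all nodes suppresses it except
with probability `q`. The number of discovered coordinates is at most the number of heads, of mean
`K * T * q`, even if communication is free (`output_mem_vanishing_max`). The variance constraint
allows `q = M₀² / (M₀² + σ²)`.

The objective is the sum of one function per block, and a single zero coordinate within a block
makes that block's value nonnegative, which costs its whole optimal value (`hardGap_ge`). Taking
`N₁` of order `M / √(rε)` and `N₂` of order `M² / (rε)` makes these costs exceed `ε`. The saddle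
point case adds a variable `ζ` on which the functions do not depend. -/

/-- All variables of node `i` belong to the subspace `U i`. -/
structure State.MemIn (S : State n H) (U : Fin n → Submodule ℝ H) : Prop where
  x : ∀ i, S.x i ∈ U i
  xPrev : ∀ i, S.xPrev i ∈ U i
  xTilde : ∀ i, S.xTilde i ∈ U i
  xBar : ∀ i, S.xBar i ∈ U i
  y : ∀ i, S.y i ∈ U i
  yBar : ∀ i, S.yBar i ∈ U i
  z : ∀ i, S.z i ∈ U i
  zBar : ∀ i, S.zBar i ∈ U i
  m : ∀ i, S.m i ∈ U i

theorem innerLoop_mem (p : Params r) (g : Fin n → H → Ξ → H) (k : ℕ) (s : ℕ → Ξ)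
    (xk y : Fin n → H) (V : ℕ → Fin n → Submodule ℝ H) (hV : ∀ i, Monotone fun t => V t i)
    (hg : ∀ t i x, x ∈ V t i → g i x (s t) ∈ V (t + 1) i)
    (hx : ∀ i, xk i ∈ V 0 i) (hy : ∀ i, y i ∈ V 0 i) (t : ℕ) (i : Fin n) :
    innerLoop p g k s xk y t i ∈ V t i := by
  induction t with
  | zero => exact hx i
  | succ t ih =>
    have h0 : V 0 i ≤ V (t + 1) i := hV i (Nat.zero_le _)
    have h1 : V t i ≤ V (t + 1) i := hV i (Nat.le_succ _)
    refine Submodule.smul_mem _ _ (sub_mem (h1 ih) (Submodule.smul_mem _ _ ?_))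
    exact sub_mem (sub_mem (hg t i _ ih) (h0 (hy i))) (Submodule.smul_mem _ _ (h0 (hx i)))

theorem gossip_mem {W : Matrix (Fin n) (Fin n) ℝ} {U U' : Fin n → Submodule ℝ H}
    (hU : ∀ i, U i ≤ U' i) (hW : ∀ i j, i ≠ j → W i j ≠ 0 → U j ≤ U' i)
    {v : Fin n → H} (hv : ∀ i, v i ∈ U i) (i : Fin n) : gossip W v i ∈ U' i := by
  refine Submodule.sum_mem _ fun j _ => ?_
  by_cases hij : i = j
  · subst hij
    exact Submodule.smul_mem _ _ (hU _ (hv _))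
  · by_cases h0 : W i j = 0
    · simp [h0]
    · exact Submodule.smul_mem _ _ (hW i j hij h0 (hv j))

/-- If the oracle calls, the gossip steps and the passage of time respect the subspaces `V k t i`,
then before iteration `k` all variables of node `i` belong to `V k 0 i`. -/
theorem run_memIn (p : Params r) (g : Fin n → H → Ξ → H) (T : ℕ)
    (W : ℕ → Matrix (Fin n) (Fin n) ℝ) (s : ℕ → ℕ → Ξ) (V : ℕ → ℕ → Fin n → Submodule ℝ H)
    (hV : ∀ k i, Monotone fun t => V k t i) (hnext : ∀ k i, V k T i ≤ V (k + 1) 0 i)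
    (hg : ∀ k t i x, x ∈ V k t i → g i x (s k t) ∈ V k (t + 1) i)
    (hW : ∀ k i j, i ≠ j → W k i j ≠ 0 → V k 0 j ≤ V (k + 1) 0 i) (k : ℕ) :
    (run p g T W s k).MemIn (V k 0) := by
  induction k with
  | zero => constructor <;> exact fun i => zero_mem _
  | succ k ih =>
    set S := run p g T W s k
    have h0T : ∀ t ≤ T, ∀ i, V k t i ≤ V (k + 1) 0 i := fun t ht i =>
      (hV k i ht).trans (hnext k i)
    have h0 : ∀ i, V k 0 i ≤ V (k + 1) 0 i := h0T 0 (Nat.zero_le _)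
    have sm : ∀ {i : Fin n} (a : ℝ) {v : H}, v ∈ V k 0 i → a • v ∈ V k 0 i := fun a _ h =>
      Submodule.smul_mem _ a h
    have sm' : ∀ {i : Fin n} (a : ℝ) {v : H}, v ∈ V (k + 1) 0 i → a • v ∈ V (k + 1) 0 i :=
      fun a _ h => Submodule.smul_mem _ a h
    have hyU : ∀ i, ((p.α k : ℝ) • S.y + (1 - (p.α k : ℝ)) • S.yBar) i ∈ V k 0 i := fun i =>
      add_mem (sm _ (ih.y i)) (sm _ (ih.yBar i))
    have hzU : ∀ i, ((p.α k : ℝ) • S.z + (1 - (p.α k : ℝ)) • S.zBar) i ∈ V k 0 i := fun i =>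
      add_mem (sm _ (ih.z i)) (sm _ (ih.zBar i))
    have hgy : ∀ i, (p.ryz • (((p.α k : ℝ) • S.y + (1 - (p.α k : ℝ)) • S.yBar) +
        ((p.α k : ℝ) • S.z + (1 - (p.α k : ℝ)) • S.zBar))) i ∈ V k 0 i := fun i =>
      sm _ (add_mem (hyU i) (hzU i))
    -- The gossiped vectors are built from variables known before the iteration, so a communication
    -- transports only information in `V k 0`.
    have hgT := gossip_mem h0 (hW k) hgy
    have hgH := gossip_mem h0 (hW k) (v := p.ryz • (((p.α k : ℝ) • S.y +
      (1 - (p.α k : ℝ)) • S.yBar) + ((p.α k : ℝ) • S.z + (1 - (p.α k : ℝ)) • S.zBar)) + S.m)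
      fun i => add_mem (hgy i) (ih.m i)
    have hxH : ∀ i, (S.x + (p.γ k : ℝ) • (S.xTilde - S.xPrev)) i ∈ V k 0 i := fun i =>
      add_mem (ih.x i) (sm _ (sub_mem (ih.xTilde i) (ih.xPrev i)))
    -- The new `y` involves no gossiped vector, so the inner loop still starts in `V k 0`.
    have hy' : ∀ i, (S.y - (p.ηy k : ℝ) • (p.ryz • (((p.α k : ℝ) • S.y +
        (1 - (p.α k : ℝ)) • S.yBar) + ((p.α k : ℝ) • S.z + (1 - (p.α k : ℝ)) • S.zBar)) +
        (S.x + (p.γ k : ℝ) • (S.xTilde - S.xPrev)))) i ∈ V k 0 i := fun i =>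
      sub_mem (ih.y i) (sm _ (add_mem (hgy i) (hxH i)))
    have hu := innerLoop_mem p g k (s k) S.x _ (V k) (hV k) (hg k) ih.x hy'
    have hxT : ∀ i, ((1 / T : ℝ) • ∑ t ∈ Finset.Icc 1 T, innerLoop p g k (s k) S.x _ t) i ∈
        V (k + 1) 0 i := fun i => by
      rw [Pi.smul_apply, Finset.sum_apply]
      exact sm' _ (Submodule.sum_mem _ fun t ht => h0T t (Finset.mem_Icc.1 ht).2 i (hu t i))
    exact
      { x := fun i => add_mem (sm' _ (h0T T le_rfl i (hu T i))) (sm' _ (hxT i))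
        xPrev := fun i => h0 i (ih.x i)
        xTilde := hxT
        xBar := fun i => add_mem (sm' _ (hxT i)) (sm' _ (h0 i (ih.xBar i)))
        y := fun i => h0 i (hy' i)
        yBar := fun i => h0 i (add_mem (hyU i) (sm _ (sub_mem (hy' i) (ih.y i))))
        z := fun i => sub_mem (h0 i (ih.z i)) (sm' _ (hgH i))
        zBar := fun i => sub_mem (h0 i (hzU i)) (sm' _ (hgT i))
        m := fun i => sm' _ (sub_mem (add_mem (h0 i (ih.m i)) (h0 i (hgy i))) (hgH i)) }

theorem output_mem (p : Params r) (g : Fin n → H → Ξ → H) (K T : ℕ)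
    (W : ℕ → Matrix (Fin n) (Fin n) ℝ) (s : ℕ → ℕ → Ξ) (V : ℕ → ℕ → Fin n → Submodule ℝ H)
    (hV : ∀ k i, Monotone fun t => V k t i) (hnext : ∀ k i, V k T i ≤ V (k + 1) 0 i)
    (hg : ∀ k t i x, x ∈ V k t i → g i x (s k t) ∈ V k (t + 1) i)
    (hW : ∀ k i j, i ≠ j → W k i j ≠ 0 → V k 0 j ≤ V (k + 1) 0 i)
    (U : Submodule ℝ H) (hU : ∀ i, V K 0 i ≤ U) : output p g K T W s ∈ U := by
  have hmono : ∀ i, Monotone fun k => V k 0 i := fun i =>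
    monotone_nat_of_le_succ fun k => (hV k i (Nat.zero_le T)).trans (hnext k i)
  refine Submodule.smul_mem _ _ (Submodule.sum_mem _ fun i _ => ?_)
  rw [Pi.smul_apply, Finset.sum_apply]
  refine Submodule.smul_mem _ _ (Submodule.sum_mem _ fun k hk => ?_)
  refine Submodule.smul_mem _ _ (hU i (hmono i (Finset.mem_Icc.1 hk).2 ?_))
  exact (run_memIn p g T W s V hV hnext hg hW k).xBar i

end Invariance

/-! ## Star-shaped and complete networks -/

/-- The network that uses the gossip matrix `W k` at time `commTime k`, and an edge from `j` to `i`
whenever the entry `(i, j)` of the current matrix is nonzero. -/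
def Network.ofSeq {n : ℕ} (commTime : ℕ → ℝ≥0) (W : ℕ → Matrix (Fin n) (Fin n) ℝ)
    (hrow : ∀ k i, ∑ j, W k i j = 0) (hcol : ∀ k j, ∑ i, W k i j = 0) : Network n where
  edges τ := {e | W (Function.invFun commTime τ) e.2 e.1 ≠ 0}
  W τ := W (Function.invFun commTime τ)
  supported _ _ _ _ h := by simpa using h
  row_sum _ := hrow _
  col_sum _ := hcol _

/-- The Laplacian of the star with center `c`, divided by the number of nodes. -/
def starMatrix {n : ℕ} (c : Fin n) : Matrix (Fin n) (Fin n) ℝ := fun i j =>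
  (if i = j then 1 else 0) - if i = c then (1 / n : ℝ) else
    (1 - 1 / n) * (if i = j then 1 else 0) + 1 / n * (if j = c then 1 else 0)

/-- The Laplacian of the complete graph, divided by the number of nodes. -/
def completeMatrix (n : ℕ) : Matrix (Fin n) (Fin n) ℝ := fun i j =>
  (if i = j then 1 else 0) - 1 / n

theorem starMatrix_row_sum {n : ℕ} (c i : Fin n) : ∑ j, starMatrix c i j = 0 := by
  have hn : (n : ℝ) ≠ 0 := by
    have := c.pos
    positivity
  unfold starMatrix
  rw [Finset.sum_sub_distrib]
  by_cases hi : i = c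
  · simp [hi, hn]
  · simp [hi, Finset.sum_add_distrib]

theorem starMatrix_col_sum {n : ℕ} (c j : Fin n) : ∑ i, starMatrix c i j = 0 := by
  have hn : (n : ℝ) ≠ 0 := by
    have := c.pos
    positivity
  -- The exceptional row `c` is isolated as a correction supported at `i = c`, so that the column
  -- sum splits into single-point sums.
  have h : ∀ i, starMatrix c i j = (if i = j then 1 else 0) -
      ((1 - 1 / n) * (if i = j then 1 else 0) + 1 / n * (if j = c then 1 else 0)) -
      (if i = c then (1 / n - ((1 - 1 / n) * (if c = j then 1 else 0) +
        1 / n * (if j = c then 1 else 0)) : ℝ) else 0) := fun i => by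
    unfold starMatrix
    by_cases hi : i = c
    · simp [hi]
    · simp [hi]
  simp_rw [h, Finset.sum_sub_distrib, Finset.sum_add_distrib, ← Finset.mul_sum]
  by_cases hj : j = c
  · simp [hj, hn]
  · simp [hj, Ne.symm hj]

theorem starMatrix_contraction {n : ℕ} (c : Fin n) (x : Fin n → ℝ) (hx : ∑ i, x i = 0) :
    ∑ i, ((starMatrix c).mulVec x i - x i) ^ 2 ≤ (1 - 1 / n) * ∑ i, x i ^ 2 := by
  have hn : (1 : ℝ) ≤ n := by exact_mod_cast c.pos
  have hn0 : (n : ℝ) ≠ 0 := by positivity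
  have h1 : (0 : ℝ) ≤ 1 / n := by positivity
  have h2 : (1 : ℝ) / n ≤ 1 := by rw [div_le_one (by positivity)]; exact hn
  -- `I - W` averages at the center, giving `0` for zero-sum `x`, and elsewhere takes a convex
  -- combination of `x i` and `x c`. Jensen bounds its square; the `x c ^ 2` terms cancel after
  -- summation.
  have key : ∀ i, ((starMatrix c).mulVec x i - x i) ^ 2 ≤
      (1 - 1 / n) * x i ^ 2 + 1 / n * x c ^ 2 - if i = c then x c ^ 2 else 0 := fun i => by
    have e : (starMatrix c).mulVec x i - x i = if i = c then 0 else
        -((1 - 1 / n) * x i + 1 / n * x c) := by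
      simp only [Matrix.mulVec, dotProduct, starMatrix]
      by_cases hi : i = c
      · simp [hi, sub_mul, Finset.sum_sub_distrib, ← Finset.mul_sum, hx]
      · simp [hi, sub_mul, add_mul, Finset.sum_sub_distrib, Finset.sum_add_distrib]
    rw [e]
    by_cases hi : i = c
    · simp only [hi, if_true]
      nlinarith
    · simp only [hi, if_false]
      nlinarith [mul_nonneg (mul_nonneg h1 (sub_nonneg.2 h2)) (sq_nonneg (x i - x c))]
  refine (Finset.sum_le_sum fun i _ => key i).trans (le_of_eq ?_)
  simp only [Finset.sum_sub_distrib, Finset.sum_add_distrib, ← Finset.mul_sum, Finset.sum_const,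
    Finset.card_univ, Fintype.card_fin, Finset.sum_ite_eq', Finset.mem_univ, if_true,
    nsmul_eq_mul]
  field_simp
  ring

theorem starMatrix_eq_zero {n : ℕ} {c i j : Fin n} (hij : i ≠ j) (hi : i ≠ c) (hj : j ≠ c) :
    starMatrix c i j = 0 := by
  simp [starMatrix, hij, hi, hj]

theorem completeMatrix_row_sum {n : ℕ} (hn : 0 < n) (i : Fin n) :
    ∑ j, completeMatrix n i j = 0 := by
  have : (n : ℝ) ≠ 0 := by positivity
  simp [completeMatrix, Finset.sum_sub_distrib, this]

theorem completeMatrix_col_sum {n : ℕ} (hn : 0 < n) (j : Fin n) :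
    ∑ i, completeMatrix n i j = 0 := by
  have : (n : ℝ) ≠ 0 := by positivity
  simp [completeMatrix, Finset.sum_sub_distrib, this]

theorem completeMatrix_mulVec {n : ℕ} (x : Fin n → ℝ) (hx : ∑ i, x i = 0) (i : Fin n) :
    (completeMatrix n).mulVec x i = x i := by
  simp [completeMatrix, Matrix.mulVec, dotProduct, sub_mul, Finset.sum_sub_distrib,
    ← Finset.mul_sum, hx]

/-! ## Propagation of information -/

/-- With `m` nodes of each type `i % 3`, the level of information that node `i` can have before the
communication `k`, if the nodes of type `2` are the centers of stars in cyclic order, and a node of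
type `b ∈ {0, 1}` can raise a level of parity `b` by one. -/
def level (m k i : ℕ) : ℕ :=
  if i % 3 = 2 then (k + (m - 1 - i / 3)) / m
  else if k / m % 2 = i % 3 then k / m + 1 else k / m

theorem level_le {m : ℕ} (hm : 0 < m) (k i : ℕ) : level m k i ≤ k / m + 1 := by
  unfold level
  split_ifs
  · rw [← Nat.add_div_right _ hm]
    exact Nat.div_le_div_right (by omega)
  all_goals omega

theorem le_level (m k i : ℕ) : k / m ≤ level m k i := by
  unfold level
  split_ifs
  · exact Nat.div_le_div_right (by omega)
  all_goals omega

/-- The link that would raise a vector of level `l` to `l + 1` has parity `l % 2`, so a node never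
owns the link that follows its level: the level already includes what its own oracle can add. -/
theorem level_mod_two_ne (m k i : ℕ) : level m k i % 2 ≠ i % 3 := by
  unfold level
  split_ifs <;> omega

theorem level_mono (m i : ℕ) : Monotone fun k => level m k i := by
  refine monotone_nat_of_le_succ fun k => ?_
  have h : k / m ≤ (k + 1) / m := Nat.div_le_div_right (Nat.le_succ k)
  unfold level
  split_ifs with h1 h2 h3 h3
  · exact Nat.div_le_div_right (by omega)
  · omega
  · rcases h.eq_or_lt with h | h
    · rw [h] at h2; omega
    · omega
  all_goals omega

/-- The center of the star at communication `k`. -/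
def center (m k : ℕ) (hm : 0 < m) : Fin (m * 3) :=
  ⟨3 * (k % m) + 2, by have := Nat.mod_lt k hm; omega⟩

theorem level_center {m : ℕ} (hm : 0 < m) (k : ℕ) : level m k (center m k hm) = k / m := by
  have h := Nat.mod_lt k hm
  have e := Nat.div_add_mod k m
  have h1 : (3 * (k % m) + 2) % 3 = 2 := by omega
  have h2 : (3 * (k % m) + 2) / 3 = k % m := by omega
  simp only [level, center, h1, h2, if_true]
  rw [show k + (m - 1 - k % m) = m - 1 + m * (k / m) by omega, Nat.add_mul_div_left _ _ hm,
    Nat.div_eq_of_lt (by omega), zero_add]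

theorem level_succ_center {m : ℕ} (hm : 0 < m) (k : ℕ) :
    k / m + 1 ≤ level m (k + 1) (center m k hm) := by
  have h := Nat.mod_lt k hm
  have e := Nat.div_add_mod k m
  have h1 : (3 * (k % m) + 2) % 3 = 2 := by omega
  have h2 : (3 * (k % m) + 2) / 3 = k % m := by omega
  simp only [level, center, h1, h2, if_true]
  rw [show k + 1 + (m - 1 - k % m) = m * (k / m + 1) by rw [mul_add]; omega,
    Nat.mul_div_cancel_left _ hm]

/-- For every condition number `χ ≥ 1` there is a network with three types of `m ≥ χ / 6` nodes
each in which information spreads no faster than `level m`. -/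
theorem exists_network {χ : ℝ} (hχ : 1 ≤ χ) {commTime : ℕ → ℝ≥0}
    (hc : Function.Injective commTime) :
    ∃ (m : ℕ) (N : Network (m * 3)), 0 < m ∧ χ / 6 ≤ m ∧ N.HasConditionNumber χ ∧
      ∀ k (i j : Fin (m * 3)), i ≠ j → N.W (commTime k) i j ≠ 0 →
        level m k j ≤ level m (k + 1) i := by
  by_cases h3 : χ < 3
  -- For `m = 1` the levels of all nodes may rise at every communication, so any gossip matrix
  -- respects them. The complete graph averages exactly and has condition number `1`.
  · refine ⟨1, Network.ofSeq commTime (fun _ => completeMatrix (1 * 3))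
      (fun _ => completeMatrix_row_sum (by norm_num))
      (fun _ => completeMatrix_col_sum (by norm_num)), one_pos, by norm_num; linarith, ?_, ?_⟩
    · intro τ x hx
      have h : (0 : ℝ) ≤ 1 - 1 / χ := by
        rw [sub_nonneg, div_le_one (by linarith)]; exact hχ
      have e : ∑ i, ((completeMatrix (1 * 3)).mulVec x i - x i) ^ 2 = 0 :=
        Finset.sum_eq_zero fun i _ => by rw [completeMatrix_mulVec x hx]; simp
      exact e.trans_le (mul_nonneg h (Finset.sum_nonneg fun _ _ => sq_nonneg _))
    · intro k i j _ _
      have h1 := level_le one_pos k j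
      have h2 := le_level 1 (k + 1) i
      simp only [Nat.div_one] at h1 h2
      omega
  · push Not at h3
    -- The star on `3 * m ≤ χ` nodes contracts by `1 - 1 / (3 * m)`; rounding down loses at most a
    -- factor `2`, hence `χ / 6 ≤ m`.
    set m := ⌊χ / 3⌋₊
    have hm : 0 < m := Nat.floor_pos.2 (by linarith)
    have hm1 : (1 : ℝ) ≤ m := by exact_mod_cast hm
    have hle : (m : ℝ) ≤ χ / 3 := Nat.floor_le (by linarith)
    have hlt : χ / 3 < m + 1 := Nat.lt_floor_add_one _
    refine ⟨m, Network.ofSeq commTime (fun k => starMatrix (center m k hm))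
      (fun k => starMatrix_row_sum _) (fun k => starMatrix_col_sum _), hm, by linarith, ?_, ?_⟩
    · intro τ x hx
      refine (starMatrix_contraction _ x hx).trans ?_
      refine mul_le_mul_of_nonneg_right ?_ (Finset.sum_nonneg fun _ _ => sq_nonneg _)
      refine sub_le_sub_left (one_div_le_one_div_of_le (by push_cast; linarith) ?_) _
      push_cast
      linarith
    · intro k i j hij hW
      have e : (Network.ofSeq commTime (fun k => starMatrix (center m k hm))
          (fun k => starMatrix_row_sum _) (fun k => starMatrix_col_sum _)).W (commTime k) =
          starMatrix (center m k hm) := by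
        simp only [Network.ofSeq, Function.leftInverse_invFun hc k]
      rw [e] at hW
      by_cases hi : i = center m k hm
      · rw [hi]
        exact (level_le hm k j).trans (level_succ_center hm k)
      · by_cases hj : j = center m k hm
        · rw [hj, level_center]
          exact (Nat.div_le_div_right (Nat.le_succ k)).trans (le_level _ _ _)
        · exact absurd (starMatrix_eq_zero hij hi hj) hW

/-! ## Coordinates -/

section Coordinates

variable {d : ℕ}

/-- The unit vector `e_j` of `ℝ^d`, and `0` if `j ≥ d`. -/
def unitVec (d j : ℕ) : EuclideanSpace ℝ (Fin d) :=
  if h : j < d then EuclideanSpace.single ⟨j, h⟩ 1 else 0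

/-- The coordinate `x_j` of a vector `x` of `ℝ^d`, and `0` if `j ≥ d`. -/
def coord (j : ℕ) : EuclideanSpace ℝ (Fin d) →L[ℝ] ℝ :=
  innerSL ℝ (unitVec d j)

theorem coord_of_lt {j : ℕ} (h : j < d) (x : EuclideanSpace ℝ (Fin d)) :
    coord j x = x ⟨j, h⟩ := by
  simp [coord, unitVec, h, EuclideanSpace.inner_single_left]

theorem inner_unitVec (j : ℕ) (x : EuclideanSpace ℝ (Fin d)) :
    inner ℝ (unitVec d j) x = coord j x := rfl

theorem coord_unitVec_of_ne {i j : ℕ} (h : i ≠ j) : coord i (unitVec d j) = 0 := by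
  by_cases hi : i < d
  · rw [coord_of_lt hi]
    unfold unitVec
    split_ifs <;> simp [h]
  · simp [coord, unitVec, hi]

theorem norm_unitVec_le (j : ℕ) : ‖unitVec d j‖ ≤ 1 := by
  unfold unitVec
  split_ifs <;> simp

theorem abs_coord_le (j : ℕ) (x : EuclideanSpace ℝ (Fin d)) : |coord j x| ≤ ‖x‖ := by
  refine (abs_real_inner_le_norm (unitVec d j) x).trans ?_
  exact mul_le_of_le_one_left (norm_nonneg _) (norm_unitVec_le j)

theorem norm_sq_eq_sum_coord (x : EuclideanSpace ℝ (Fin d)) :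
    ‖x‖ ^ 2 = ∑ j ∈ Finset.range d, coord j x ^ 2 := by
  rw [EuclideanSpace.real_norm_sq_eq, ← Fin.sum_univ_eq_sum_range fun j => coord j x ^ 2]
  exact Finset.sum_congr rfl fun j _ => by rw [coord_of_lt j.2]

/-- The vectors whose coordinates from `a` up to `b - 1` vanish. -/
def vanishing (d a b : ℕ) : Submodule ℝ (EuclideanSpace ℝ (Fin d)) where
  carrier := {x | ∀ j, a ≤ j → j < b → coord j x = 0}
  add_mem' hx hy j ha hb := by rw [map_add, hx j ha hb, hy j ha hb, add_zero]
  zero_mem' _ _ _ := map_zero _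
  smul_mem' c _ hx j ha hb := by rw [map_smul, hx j ha hb, smul_zero]

theorem vanishing_mono (b : ℕ) : Monotone fun a => vanishing d a b :=
  fun _ _ h _ hx j ha hb => hx j (h.trans ha) hb

theorem unitVec_mem_vanishing {a b j : ℕ} (h : j < a ∨ b ≤ j) : unitVec d j ∈ vanishing d a b :=
  fun _ _ _ => coord_unitVec_of_ne (by omega)

end Coordinates

/-! ## Subgradients of Lipschitz functions -/

/-- Testing the subgradient inequality at `x + g` gives `‖g‖² ≤ L * ‖g‖`. -/
theorem norm_le_of_mem_subdiff {E : Type*} [NormedAddCommGroup E] [InnerProductSpace ℝ E]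
    {f : E → ℝ} {L : ℝ} (hL : 0 ≤ L) (hf : ∀ x h, f (x + h) ≤ f x + L * ‖h‖) {x g : E}
    (hg : g ∈ subdiff f x) : ‖g‖ ≤ L := by
  have h1 := hg (x + g)
  rw [add_sub_cancel_left, real_inner_self_eq_norm_sq] at h1
  have h2 := hf x g
  by_contra! h
  nlinarith

theorem sign_mul_sub_le (a b : ℝ) : Real.sign a * (b - a) ≤ |b| - |a| := by
  have h1 := le_abs_self b
  have h2 := neg_abs_le b
  rcases lt_trichotomy a 0 with h | h | h
  · rw [Real.sign_of_neg h, abs_of_neg h]; linarith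
  · simp [h]
  · rw [Real.sign_of_pos h, abs_of_pos h]; linarith

theorem measurable_sign : Measurable Real.sign := by
  unfold Real.sign
  exact Measurable.ite measurableSet_Iio measurable_const
    (Measurable.ite measurableSet_Ioi measurable_const measurable_const)

/-! ## The chain -/

section Chain

variable {d : ℕ}

/-- The links of the chain: `-x_0` and `|x_e - x_{e+1}|`. -/
def chainLink : ℕ → EuclideanSpace ℝ (Fin d) → ℝ
  | 0, x => -coord 0 x
  | e + 1, x => |coord e x - coord (e + 1) x|

/-- A subgradient of `chainLink`. -/
def chainLinkGrad : ℕ → EuclideanSpace ℝ (Fin d) → EuclideanSpace ℝ (Fin d)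
  | 0, _ => -unitVec d 0
  | e + 1, x => Real.sign (coord e x - coord (e + 1) x) • (unitVec d e - unitVec d (e + 1))

theorem chainLinkGrad_mem (e : ℕ) (x : EuclideanSpace ℝ (Fin d)) :
    chainLinkGrad e x ∈ subdiff (chainLink e) x := by
  intro y
  cases e with
  | zero => simp [chainLinkGrad, chainLink, inner_unitVec]
  | succ e =>
    have h := sign_mul_sub_le (coord e x - coord (e + 1) x) (coord e y - coord (e + 1) y)
    simp only [chainLinkGrad, chainLink, inner_smul_left, inner_sub_left, inner_unitVec, map_sub,
      conj_trivial]
    have e1 : coord e y - coord e x - (coord (e + 1) y - coord (e + 1) x) =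
      coord e y - coord (e + 1) y - (coord e x - coord (e + 1) x) := by ring
    rw [e1]
    linarith

theorem convexOn_chainLink (e : ℕ) :
    ConvexOn ℝ Set.univ (chainLink e : EuclideanSpace ℝ (Fin d) → ℝ) := by
  refine ⟨convex_univ, fun x _ y _ a b ha hb _ => ?_⟩
  cases e with
  | zero => simp [chainLink]
  | succ e =>
    simp only [chainLink, map_add, map_smul, smul_eq_mul]
    have h := abs_add_le (a * (coord e x - coord (e + 1) x)) (b * (coord e y - coord (e + 1) y))
    rw [abs_mul, abs_mul, abs_of_nonneg ha, abs_of_nonneg hb] at h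
    refine le_trans (le_of_eq ?_) h
    congr 1
    ring

theorem measurable_chainLinkGrad (e : ℕ) :
    Measurable (chainLinkGrad e : EuclideanSpace ℝ (Fin d) → EuclideanSpace ℝ (Fin d)) := by
  cases e with
  | zero => exact measurable_const
  | succ e =>
    refine (measurable_sign.comp ?_).smul_const _
    exact (coord e).continuous.measurable.sub (coord (e + 1)).continuous.measurable

/-- The links `e < N` with `e % 2 = b`. -/
def chainPart (N b : ℕ) (x : EuclideanSpace ℝ (Fin d)) : ℝ :=
  ∑ e ∈ Finset.range N with e % 2 = b, chainLink e x

/-- A subgradient of `chainPart`. -/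
def chainPartGrad (N b : ℕ) (x : EuclideanSpace ℝ (Fin d)) : EuclideanSpace ℝ (Fin d) :=
  ∑ e ∈ Finset.range N with e % 2 = b, chainLinkGrad e x

theorem chainPartGrad_mem (N b : ℕ) (x : EuclideanSpace ℝ (Fin d)) :
    chainPartGrad N b x ∈ subdiff (chainPart N b) x := by
  intro y
  rw [chainPartGrad, sum_inner, chainPart, ← Finset.sum_add_distrib]
  exact Finset.sum_le_sum fun e _ => chainLinkGrad_mem e x y

theorem convexOn_chainPart (N b : ℕ) :
    ConvexOn ℝ Set.univ (chainPart N b : EuclideanSpace ℝ (Fin d) → ℝ) := by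
  refine ⟨convex_univ, fun x hx y hy u v hu hv huv => ?_⟩
  simp only [chainPart, smul_eq_mul, Finset.mul_sum]
  rw [← Finset.sum_add_distrib]
  exact Finset.sum_le_sum fun e _ => (convexOn_chainLink e).2 hx hy hu hv huv

/-- Each coordinate occurs in at most two links, so the increment is at most twice the `ℓ¹` norm of
the first `N` coordinates of `h`; Cauchy–Schwarz gives `√N`. -/
theorem chainPart_add_le {N : ℕ} (b : ℕ) (hN : N ≤ d) (x h : EuclideanSpace ℝ (Fin d)) :
    chainPart N b (x + h) ≤ chainPart N b x + 2 * √N * ‖h‖ := by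
  let B : ℕ → ℝ := fun e => |coord e h| + if e = 0 then 0 else |coord (e - 1) h|
  have hB0 : ∀ e, 0 ≤ B e := fun e => by
    simp only [B]
    split_ifs <;> positivity
  have h1 : chainPart N b (x + h) ≤ chainPart N b x + ∑ e ∈ Finset.range N, B e := by
    have h2 : ∑ e ∈ Finset.range N with e % 2 = b, B e ≤ ∑ e ∈ Finset.range N, B e :=
      Finset.sum_le_sum_of_subset_of_nonneg (Finset.filter_subset _ _) fun e _ _ => hB0 e
    refine le_trans ?_ (add_le_add_right h2 _)
    rw [chainPart, chainPart, ← Finset.sum_add_distrib]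
    refine Finset.sum_le_sum fun e _ => ?_
    cases e with
    | zero =>
      simp only [chainLink, map_add, B, if_true]
      linarith [neg_abs_le (coord 0 h)]
    | succ e =>
      simp only [chainLink, map_add, B, Nat.add_sub_cancel, Nat.succ_ne_zero, if_false]
      have h3 := abs_add_le (coord e x - coord (e + 1) x) (coord e h - coord (e + 1) h)
      have h4 := abs_sub (coord e h) (coord (e + 1) h)
      rw [show coord e x + coord e h - (coord (e + 1) x + coord (e + 1) h) =
        coord e x - coord (e + 1) x + (coord e h - coord (e + 1) h) by ring]
      linarith
  have h2 : ∑ e ∈ Finset.range N, B e ≤ 2 * ∑ e ∈ Finset.range N, |coord e h| := by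
    cases N with
    | zero => simp
    | succ N =>
      simp only [B]
      rw [Finset.sum_add_distrib, Finset.sum_range_succ' (fun e => if e = 0 then 0 else _)]
      simp only [Nat.succ_ne_zero, if_false, Nat.add_sub_cancel, if_true]
      have := Finset.sum_range_succ (fun e => |coord e h|) N
      linarith [abs_nonneg (coord N h)]
  have h3 : ∑ e ∈ Finset.range N, |coord e h| ≤ √N * ‖h‖ := by
    refine abs_le_of_sq_le_sq' ?_ (by positivity) |>.2
    refine sq_sum_le_card_mul_sum_sq.trans ?_
    rw [mul_pow, Real.sq_sqrt (Nat.cast_nonneg N), Finset.card_range, norm_sq_eq_sum_coord]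
    simp only [sq_abs]
    refine mul_le_mul_of_nonneg_left ?_ (Nat.cast_nonneg N)
    exact Finset.sum_le_sum_of_subset_of_nonneg (Finset.range_subset_range.2 hN)
      fun e _ _ => sq_nonneg _
  linarith

/-- Only the link joining coordinates `l - 1` and `l` (or `-x_0` if `l = 0`) could activate
coordinate `l`, and its index `l` has the wrong parity. -/
theorem chainPartGrad_mem_vanishing_level {N b l : ℕ} (hl : l % 2 ≠ b)
    {x : EuclideanSpace ℝ (Fin d)} (hx : x ∈ vanishing d l N) :
    chainPartGrad N b x ∈ vanishing d l N := by
  refine Submodule.sum_mem _ fun e he => ?_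
  obtain ⟨he, hb⟩ := Finset.mem_filter.1 he
  have he := Finset.mem_range.1 he
  cases e with
  | zero => exact neg_mem (unitVec_mem_vanishing (by omega))
  | succ e =>
    by_cases hel : e < l
    · exact Submodule.smul_mem _ _
        (sub_mem (unitVec_mem_vanishing (by omega)) (unitVec_mem_vanishing (by
          left
          rcases Nat.lt_or_ge (e + 1) l with h | h
          · exact h
          · exact absurd (by rw [← hb]; congr 1; omega) hl)))
    -- Both ends of this link vanish at `x`, and `Real.sign 0 = 0` makes its chosen subgradient
    -- zero.
    · have h0 : coord e x - coord (e + 1) x = 0 := by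
        rw [hx e (by omega) (by omega), hx (e + 1) (by omega) he, sub_zero]
      simp [chainLinkGrad, h0]

theorem chainPartGrad_mem_vanishing_of_le {N a : ℕ} (b c : ℕ) (h : N ≤ a)
    (x : EuclideanSpace ℝ (Fin d)) : chainPartGrad N b x ∈ vanishing d a c := by
  refine Submodule.sum_mem _ fun e he => ?_
  have he := Finset.mem_range.1 (Finset.mem_filter.1 he).1
  cases e with
  | zero => exact neg_mem (unitVec_mem_vanishing (by omega))
  | succ e =>
    exact Submodule.smul_mem _ _
      (sub_mem (unitVec_mem_vanishing (by omega)) (unitVec_mem_vanishing (by omega)))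

theorem chainPart_two (N : ℕ) (x : EuclideanSpace ℝ (Fin d)) : chainPart N 2 x = 0 :=
  Finset.sum_eq_zero fun e he => by
    have := (Finset.mem_filter.1 he).2
    omega

theorem chainPart_zero_add_one (N : ℕ) (x : EuclideanSpace ℝ (Fin d)) :
    chainPart N 0 x + chainPart N 1 x = ∑ e ∈ Finset.range N, chainLink e x := by
  rw [chainPart, chainPart, ← Finset.sum_filter_add_sum_filter_not (Finset.range N)
    (fun e => e % 2 = 0)]
  simp only [Nat.mod_two_not_eq_zero]

/-- Telescoping: `-x_j` is `-x_0` plus the differences `x_e - x_{e+1}`. Hence one zero coordinate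
forces the chain to be nonnegative. -/
theorem neg_coord_le_chain (x : EuclideanSpace ℝ (Fin d)) {j N : ℕ} (hj : j < N) :
    -coord j x ≤ ∑ e ∈ Finset.range N, chainLink e x := by
  have h1 : ∀ j, -coord j x ≤ ∑ e ∈ Finset.range (j + 1), chainLink e x := fun j => by
    induction j with
    | zero => simp [chainLink]
    | succ j ih =>
      rw [Finset.sum_range_succ]
      have h : chainLink (j + 1) x = |coord j x - coord (j + 1) x| := rfl
      linarith [le_abs_self (coord j x - coord (j + 1) x)]
  obtain ⟨N, rfl⟩ := Nat.exists_eq_add_of_lt hj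
  refine (h1 j).trans ?_
  refine Finset.sum_le_sum_of_subset_of_nonneg
    (Finset.range_subset_range.2 (by omega)) fun e _ he => ?_
  cases e with
  | zero => simp at he
  | succ e => exact abs_nonneg _

end Chain

/-! ## The maximum of coordinates -/

section Max

variable {d : ℕ}

/-- The maximum of the `N` coordinates `x_a, …, x_{a+N-1}`. -/
def maxCoord (a N : ℕ) (x : EuclideanSpace ℝ (Fin d)) : ℝ :=
  ⨆ j : Fin N, coord (a + j) x

theorem coord_le_maxCoord (a : ℕ) {N : ℕ} (x : EuclideanSpace ℝ (Fin d)) (j : Fin N) :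
    coord (a + j) x ≤ maxCoord a N x :=
  le_ciSup (f := fun j : Fin N => coord (a + j) x) (Set.finite_range _).bddAbove j

theorem maxCoord_le {a N : ℕ} (hN : 0 < N) {x : EuclideanSpace ℝ (Fin d)} {u : ℝ}
    (h : ∀ j : Fin N, coord (a + j) x ≤ u) : maxCoord a N x ≤ u :=
  have : Nonempty (Fin N) := ⟨⟨0, hN⟩⟩
  ciSup_le h

theorem convexOn_maxCoord (a : ℕ) {N : ℕ} (hN : 0 < N) :
    ConvexOn ℝ Set.univ (maxCoord a N : EuclideanSpace ℝ (Fin d) → ℝ) := by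
  refine ⟨convex_univ, fun x _ y _ u v hu hv _ => maxCoord_le hN fun j => ?_⟩
  simp only [map_add, map_smul, smul_eq_mul]
  exact add_le_add (mul_le_mul_of_nonneg_left (coord_le_maxCoord a x j) hu)
    (mul_le_mul_of_nonneg_left (coord_le_maxCoord a y j) hv)

theorem maxCoord_add_le (a : ℕ) {N : ℕ} (hN : 0 < N) (x h : EuclideanSpace ℝ (Fin d)) :
    maxCoord a N (x + h) ≤ maxCoord a N x + ‖h‖ :=
  maxCoord_le hN fun j => by
    rw [map_add]
    exact add_le_add (coord_le_maxCoord a x j) ((le_abs_self _).trans (abs_coord_le _ h))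

/-- `j` is the first index of a maximal coordinate among `x_a, …, x_{a+N-1}`. -/
def IsFirstMax (a : ℕ) {N : ℕ} (x : EuclideanSpace ℝ (Fin d)) (j : Fin N) : Prop :=
  (∀ i : Fin N, coord (a + i) x ≤ coord (a + j) x) ∧
    ∀ i : Fin N, i < j → coord (a + i) x < coord (a + j) x

theorem exists_isFirstMax (a : ℕ) {N : ℕ} (hN : 0 < N) (x : EuclideanSpace ℝ (Fin d)) :
    ∃ j : Fin N, IsFirstMax a x j := by
  have : Nonempty (Fin N) := ⟨⟨0, hN⟩⟩
  let s : Finset (Fin N) := {j | ∀ i : Fin N, coord (a + i) x ≤ coord (a + j) x}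
  have mem_s : ∀ j, j ∈ s ↔ ∀ i : Fin N, coord (a + i) x ≤ coord (a + j) x := fun j => by simp [s]
  have hs : s.Nonempty := by
    obtain ⟨j, hj⟩ := Finite.exists_max fun j : Fin N => coord (a + j) x
    exact ⟨j, (mem_s j).2 hj⟩
  have hm := (mem_s _).1 (s.min'_mem hs)
  refine ⟨s.min' hs, hm, fun i hi => ?_⟩
  by_contra! h
  exact (s.min'_le i ((mem_s i).2 fun k => (hm k).trans h)).not_gt hi

open Classical in
/-- A subgradient of `maxCoord`: the unit vector of the first maximal coordinate. -/
def maxGrad (a N : ℕ) (x : EuclideanSpace ℝ (Fin d)) : EuclideanSpace ℝ (Fin d) :=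
  ∑ j : Fin N, (if IsFirstMax a x j then (1 : ℝ) else 0) • unitVec d (a + j)

theorem maxGrad_eq {a N : ℕ} {x : EuclideanSpace ℝ (Fin d)} {j : Fin N}
    (hj : IsFirstMax a x j) : maxGrad a N x = unitVec d (a + j) := by
  rw [maxGrad, Finset.sum_eq_single j, if_pos hj, one_smul]
  · intro i _ hij
    rw [if_neg, zero_smul]
    intro hi
    rcases lt_or_gt_of_ne hij with h | h
    · exact (hj.2 i h).not_ge (hi.1 j)
    · exact (hi.2 j h).not_ge (hj.1 i)
  · exact fun h => absurd (Finset.mem_univ j) h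

theorem maxGrad_mem (a : ℕ) {N : ℕ} (hN : 0 < N) (x : EuclideanSpace ℝ (Fin d)) :
    maxGrad a N x ∈ subdiff (maxCoord a N) x := by
  intro y
  obtain ⟨j, hj⟩ := exists_isFirstMax a hN x
  rw [maxGrad_eq hj, inner_unitVec, map_sub]
  linarith [coord_le_maxCoord a y j, maxCoord_le hN hj.1]

theorem norm_maxGrad_le (a : ℕ) {N : ℕ} (hN : 0 < N) (x : EuclideanSpace ℝ (Fin d)) :
    ‖maxGrad a N x‖ ≤ 1 := by
  obtain ⟨j, hj⟩ := exists_isFirstMax a hN x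
  rw [maxGrad_eq hj]
  exact norm_unitVec_le _

/-- Writing `maxGrad` as a sum of indicators reduces this to the sets where a given index is the
first maximizer, finite intersections of half-spaces. -/
theorem measurable_maxGrad (a N : ℕ) :
    Measurable (maxGrad a N : EuclideanSpace ℝ (Fin d) → EuclideanSpace ℝ (Fin d)) := by
  refine Finset.measurable_fun_sum _ fun j _ => Measurable.smul_const ?_ _
  refine Measurable.ite ?_ measurable_const measurable_const
  have hc : ∀ i : ℕ, Measurable (coord i : EuclideanSpace ℝ (Fin d) → ℝ) := fun i =>
    (coord i).continuous.measurable
  have e : {x : EuclideanSpace ℝ (Fin d) | IsFirstMax a x j} =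
      (⋂ i : Fin N, {x | coord (a + i) x ≤ coord (a + j) x}) ∩
        ⋂ i : Fin N, ⋂ _ : i < j, {x | coord (a + i) x < coord (a + j) x} := by
    ext x
    simp [IsFirstMax]
  rw [e]
  exact (MeasurableSet.iInter fun i => measurableSet_le (hc _) (hc _)).inter
    (MeasurableSet.iInter fun i => MeasurableSet.iInter fun _ => measurableSet_lt (hc _) (hc _))

/-- The coordinates from position `l` on are all zero, hence tied, and ties go to the smallest
index: the first maximizer is at position `l` or earlier. -/
theorem maxGrad_mem_vanishing_succ {a N l : ℕ} (hN : 0 < N) {x : EuclideanSpace ℝ (Fin d)}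
    (hx : x ∈ vanishing d (a + l) (a + N)) :
    maxGrad a N x ∈ vanishing d (a + l + 1) (a + N) := by
  obtain ⟨j, hj⟩ := exists_isFirstMax a hN x
  rw [maxGrad_eq hj]
  refine unitVec_mem_vanishing (Or.inl ?_)
  by_contra h
  have hl : l < N := by have := j.2; omega
  have h1 := hj.2 ⟨l, hl⟩ (Fin.lt_def.2 (by simp only; omega))
  have h2 : coord (a + l) x = 0 := hx _ le_rfl (by omega)
  have h3 : coord (a + j) x = 0 := hx _ (by omega) (by omega)
  simp only [h2, h3, lt_irrefl] at h1

theorem maxGrad_mem_vanishing_of_le {a N b c : ℕ} (hN : 0 < N) (hc : c ≤ a)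
    (x : EuclideanSpace ℝ (Fin d)) : maxGrad a N x ∈ vanishing d b c := by
  obtain ⟨j, hj⟩ := exists_isFirstMax a hN x
  rw [maxGrad_eq hj]
  exact unitVec_mem_vanishing (Or.inr (by omega))

end Max

/-! ## The hard minimization problem -/

section Hard

/-- The function of a node of type `b`. -/
def hardFn (N₁ N₂ : ℕ) (lam M₀ : ℝ) (b : ℕ) (x : EuclideanSpace ℝ (Fin (N₁ + N₂))) : ℝ :=
  lam * chainPart N₁ b x + M₀ * maxCoord N₁ N₂ x

/-- A subgradient of `hardFn`, up to the factor `w` that replaces `M₀`. -/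
def hardGrad (N₁ N₂ : ℕ) (lam w : ℝ) (b : ℕ) (x : EuclideanSpace ℝ (Fin (N₁ + N₂))) :
    EuclideanSpace ℝ (Fin (N₁ + N₂)) :=
  lam • chainPartGrad N₁ b x + w • maxGrad N₁ N₂ x

variable {m N₁ N₂ : ℕ} {lam M₀ : ℝ}

theorem convexOn_hardFn (hN₂ : 0 < N₂) (hlam : 0 ≤ lam) (hM₀ : 0 ≤ M₀) (b : ℕ) :
    ConvexOn ℝ Set.univ (hardFn N₁ N₂ lam M₀ b) :=
  ((convexOn_chainPart N₁ b).smul hlam).add ((convexOn_maxCoord N₁ hN₂).smul hM₀)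

theorem hardGrad_mem (hN₂ : 0 < N₂) (hlam : 0 ≤ lam) (hM₀ : 0 ≤ M₀) (b : ℕ)
    (x : EuclideanSpace ℝ (Fin (N₁ + N₂))) :
    hardGrad N₁ N₂ lam M₀ b x ∈ subdiff (hardFn N₁ N₂ lam M₀ b) x := by
  intro y
  have h1 := mul_le_mul_of_nonneg_left (chainPartGrad_mem N₁ b x y) hlam
  have h2 := mul_le_mul_of_nonneg_left (maxGrad_mem N₁ hN₂ x y) hM₀
  simp only [hardGrad, hardFn, inner_add_left, inner_smul_left, conj_trivial]
  linarith

theorem hardFn_add_le (hN₂ : 0 < N₂) (hlam : 0 ≤ lam) (hM₀ : 0 ≤ M₀) (b : ℕ)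
    (x h : EuclideanSpace ℝ (Fin (N₁ + N₂))) :
    hardFn N₁ N₂ lam M₀ b (x + h) ≤
      hardFn N₁ N₂ lam M₀ b x + (lam * (2 * √N₁) + M₀) * ‖h‖ := by
  have h1 := mul_le_mul_of_nonneg_left
    (chainPart_add_le b (Nat.le_add_right N₁ N₂) x h) hlam
  have h2 := mul_le_mul_of_nonneg_left (maxCoord_add_le N₁ hN₂ x h) hM₀
  simp only [hardFn]
  linarith

theorem norm_le_of_mem_subdiff_hardFn (hN₂ : 0 < N₂) (hlam : 0 ≤ lam) (hM₀ : 0 ≤ M₀) {b : ℕ}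
    {x g : EuclideanSpace ℝ (Fin (N₁ + N₂))} (hg : g ∈ subdiff (hardFn N₁ N₂ lam M₀ b) x) :
    ‖g‖ ≤ lam * (2 * √N₁) + M₀ :=
  norm_le_of_mem_subdiff (by positivity) (hardFn_add_le hN₂ hlam hM₀ b) hg

/-- The minimization problem with node functions `hardFn`, with `m` nodes of each type. -/
def hardProblem (m N₁ N₂ : ℕ) (lam M₀ : ℝ) (hN₂ : 0 < N₂) (hlam : 0 ≤ lam) (hM₀ : 0 ≤ M₀) :
    ConvexProblem (m * 3) (N₁ + N₂) where
  f i := hardFn N₁ N₂ lam M₀ (i % 3)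
  convex _ := convexOn_hardFn hN₂ hlam hM₀ _

theorem sum_mod_three (m : ℕ) (φ : ℕ → ℝ) :
    ∑ i : Fin (m * 3), φ (i % 3) = m * (φ 0 + φ 1 + φ 2) := by
  rw [Fin.sum_univ_eq_sum_range fun i => φ (i % 3)]
  induction m with
  | zero => simp
  | succ m ih =>
    rw [show (m + 1) * 3 = m * 3 + 1 + 1 + 1 by ring, Finset.sum_range_succ,
      Finset.sum_range_succ, Finset.sum_range_succ, ih,
      show m * 3 % 3 = 0 by omega, show (m * 3 + 1) % 3 = 1 by omega,
      show (m * 3 + 1 + 1) % 3 = 2 by omega]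
    push_cast
    ring

/-- The two blocks decouple. The chain gets the factor `1 / 3` because each parity is held by one
type in three; the maximum is held by all nodes. -/
theorem objective_hardProblem (hm : 0 < m) (hN₂ : 0 < N₂) (hlam : 0 ≤ lam) (hM₀ : 0 ≤ M₀)
    (r : ℝ) (x : EuclideanSpace ℝ (Fin (N₁ + N₂))) :
    (hardProblem m N₁ N₂ lam M₀ hN₂ hlam hM₀).objective r x =
      (lam / 3 * ∑ e ∈ Finset.range N₁, chainLink e x +
        r / 2 * ∑ j ∈ Finset.range N₁, coord j x ^ 2) +
      (M₀ * maxCoord N₁ N₂ x + r / 2 * ∑ j ∈ Finset.range N₂, coord (N₁ + j) x ^ 2) := by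
  have hm' : (m : ℝ) ≠ 0 := by positivity
  rw [ConvexProblem.objective, norm_sq_eq_sum_coord, Finset.sum_range_add,
    ← chainPart_zero_add_one]
  simp only [hardProblem]
  rw [sum_mod_three m fun b => hardFn N₁ N₂ lam M₀ b x]
  simp only [hardFn, chainPart_two]
  push_cast
  field_simp
  ring

/-- Average the bounds `-u j ≤ C` with weights `μ / N` and complete the square at `u j = μ / (r *
N)`. This gives the minimum of either block, with `u = -x` for the maximum. -/
theorem neg_le_mul_add_sum_sq {N : ℕ} (hN : 0 < N) {r μ C : ℝ} (hr : 0 < r) (hμ : 0 ≤ μ)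
    {u : ℕ → ℝ} (h : ∀ j < N, -u j ≤ C) :
    -(μ ^ 2 / (2 * r * N)) ≤ μ * C + r / 2 * ∑ j ∈ Finset.range N, u j ^ 2 := by
  have hN' : (0 : ℝ) < N := by exact_mod_cast hN
  have key : ∀ j ∈ Finset.range N, -(μ ^ 2 / (2 * r * N ^ 2)) - μ / N * C ≤ r / 2 * u j ^ 2 := by
    intro j hj
    have h1 := mul_le_mul_of_nonneg_left (h j (Finset.mem_range.1 hj)) (div_nonneg hμ hN'.le)
    have h2 : 0 ≤ r / 2 * (u j - μ / (r * N)) ^ 2 := by positivity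
    have e : r / 2 * (u j - μ / (r * N)) ^ 2 =
        r / 2 * u j ^ 2 + μ / N * -u j + μ ^ 2 / (2 * r * N ^ 2) := by
      field_simp
      ring
    linarith
  have := Finset.sum_le_sum key
  rw [Finset.sum_const, Finset.card_range, nsmul_eq_mul, ← Finset.mul_sum] at this
  have e : N * (-(μ ^ 2 / (2 * r * N ^ 2)) - μ / N * C) = -(μ ^ 2 / (2 * r * N)) - μ * C := by
    field_simp
  linarith

/-- The solution of the hard problem. -/
def hardSol (N₁ N₂ : ℕ) (r lam M₀ : ℝ) : EuclideanSpace ℝ (Fin (N₁ + N₂)) :=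
  WithLp.toLp 2 fun j => if (j : ℕ) < N₁ then lam / 3 / (r * N₁) else -(M₀ / (r * N₂))

theorem coord_hardSol_of_lt {r : ℝ} {j : ℕ} (hj : j < N₁) :
    coord j (hardSol N₁ N₂ r lam M₀) = lam / 3 / (r * N₁) := by
  rw [coord_of_lt (by omega)]
  simp [hardSol, hj]

theorem coord_add_hardSol {r : ℝ} {j : ℕ} (hj : j < N₂) :
    coord (N₁ + j) (hardSol N₁ N₂ r lam M₀) = -(M₀ / (r * N₂)) := by
  rw [coord_of_lt (by omega)]
  simp [hardSol]

theorem objective_hardSol (hm : 0 < m) (hN₁ : 0 < N₁) (hN₂ : 0 < N₂) (hlam : 0 ≤ lam)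
    (hM₀ : 0 ≤ M₀) {r : ℝ} (hr : 0 < r) :
    (hardProblem m N₁ N₂ lam M₀ hN₂ hlam hM₀).objective r (hardSol N₁ N₂ r lam M₀) =
      -((lam / 3) ^ 2 / (2 * r * N₁)) + -(M₀ ^ 2 / (2 * r * N₂)) := by
  have h1 : (0 : ℝ) < N₁ := by exact_mod_cast hN₁
  have h2 : (0 : ℝ) < N₂ := by exact_mod_cast hN₂
  have e1 : ∑ e ∈ Finset.range N₁, chainLink e (hardSol N₁ N₂ r lam M₀) =
      -(lam / 3 / (r * N₁)) := by
    rw [Finset.sum_eq_single 0]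
    · rw [chainLink, coord_hardSol_of_lt hN₁]
    · intro e he h0
      obtain ⟨e, rfl⟩ := Nat.exists_eq_succ_of_ne_zero h0
      have he := Finset.mem_range.1 he
      simp only [chainLink]
      rw [coord_hardSol_of_lt (by omega), coord_hardSol_of_lt (by omega)]
      simp
    · simp [hN₁.ne']
  have e2 : maxCoord N₁ N₂ (hardSol N₁ N₂ r lam M₀) = -(M₀ / (r * N₂)) := by
    refine le_antisymm (maxCoord_le hN₂ fun j => (coord_add_hardSol j.2).le) ?_
    rw [← coord_add_hardSol hN₂]
    exact coord_le_maxCoord _ _ ⟨0, hN₂⟩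
  have e3 : ∑ j ∈ Finset.range N₁, coord j (hardSol N₁ N₂ r lam M₀) ^ 2 =
      N₁ * (lam / 3 / (r * N₁)) ^ 2 := by
    rw [Finset.sum_congr rfl fun j hj => congrArg (· ^ 2)
      (coord_hardSol_of_lt (Finset.mem_range.1 hj))]
    simp
  have e4 : ∑ j ∈ Finset.range N₂, coord (N₁ + j) (hardSol N₁ N₂ r lam M₀) ^ 2 =
      N₂ * (-(M₀ / (r * N₂))) ^ 2 := by
    rw [Finset.sum_congr rfl fun j hj => congrArg (· ^ 2)
      (coord_add_hardSol (Finset.mem_range.1 hj))]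
    simp
  rw [objective_hardProblem hm, e1, e2, e3, e4]
  field_simp
  ring

/-- Each block is bounded below by its minimum, a negative number. A zero coordinate makes one block
nonnegative, so the gap is at least minus that minimum. -/
theorem hardGap_ge (hm : 0 < m) (hN₁ : 0 < N₁) (hN₂ : 0 < N₂) (hlam : 0 ≤ lam)
    (hM₀ : 0 ≤ M₀) {r : ℝ} (hr : 0 < r) (x : EuclideanSpace ℝ (Fin (N₁ + N₂))) :
    0 ≤ (hardProblem m N₁ N₂ lam M₀ hN₂ hlam hM₀).gap r (hardSol N₁ N₂ r lam M₀) x ∧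
    (∀ l < N₁, x ∈ vanishing (N₁ + N₂) l N₁ → (lam / 3) ^ 2 / (2 * r * N₁) ≤
      (hardProblem m N₁ N₂ lam M₀ hN₂ hlam hM₀).gap r (hardSol N₁ N₂ r lam M₀) x) ∧
    (∀ l < N₂, x ∈ vanishing (N₁ + N₂) (N₁ + l) (N₁ + N₂) → M₀ ^ 2 / (2 * r * N₂) ≤
      (hardProblem m N₁ N₂ lam M₀ hN₂ hlam hM₀).gap r (hardSol N₁ N₂ r lam M₀) x) := by
  have hC : ∀ j < N₁, -coord j x ≤ ∑ e ∈ Finset.range N₁, chainLink e x := fun j hj =>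
    neg_coord_le_chain x hj
  have hD : ∀ j < N₂, coord (N₁ + j) x ≤ maxCoord N₁ N₂ x := fun j hj =>
    coord_le_maxCoord N₁ x ⟨j, hj⟩
  have h1 := neg_le_mul_add_sum_sq hN₁ hr (div_nonneg hlam zero_le_three) hC
  have h2 := neg_le_mul_add_sum_sq hN₂ hr hM₀ (u := fun j => -coord (N₁ + j) x)
    (C := maxCoord N₁ N₂ x) fun j hj => by rw [neg_neg]; exact hD j hj
  simp only [neg_sq] at h2
  rw [ConvexProblem.gap, objective_hardSol hm hN₁ hN₂ hlam hM₀ hr, objective_hardProblem hm]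
  refine ⟨by linarith, fun l hl hx => ?_, fun l hl hx => ?_⟩
  · have h3 := hC l hl
    rw [hx l le_rfl hl, neg_zero] at h3
    have h4 : 0 ≤ lam / 3 * ∑ e ∈ Finset.range N₁, chainLink e x +
        r / 2 * ∑ j ∈ Finset.range N₁, coord j x ^ 2 := by positivity
    linarith
  · have h3 := hD l hl
    rw [hx (N₁ + l) le_rfl (by omega)] at h3
    have h4 : 0 ≤ M₀ * maxCoord N₁ N₂ x +
        r / 2 * ∑ j ∈ Finset.range N₂, coord (N₁ + j) x ^ 2 := by positivity
    linarith

theorem isSolution_hardSol (hm : 0 < m) (hN₁ : 0 < N₁) (hN₂ : 0 < N₂) (hlam : 0 ≤ lam)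
    (hM₀ : 0 ≤ M₀) {r : ℝ} (hr : 0 < r) :
    (hardProblem m N₁ N₂ lam M₀ hN₂ hlam hM₀).IsSolution r (hardSol N₁ N₂ r lam M₀) :=
  fun x => sub_nonneg.1 (hardGap_ge hm hN₁ hN₂ hlam hM₀ hr x).1

end Hard

/-! ## The oracle -/

section Oracle

/-- The law of a coin that shows `true` with probability `q`. -/
def coin (q : ℝ) : Measure Bool :=
  ENNReal.ofReal q • Measure.dirac true + ENNReal.ofReal (1 - q) • Measure.dirac false

theorem isProbabilityMeasure_coin {q : ℝ} (hq : 0 ≤ q) (hq1 : q ≤ 1) :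
    IsProbabilityMeasure (coin q) := by
  constructor
  simp only [coin, Measure.add_apply, Measure.smul_apply, measure_univ, smul_eq_mul, mul_one]
  rw [← ENNReal.ofReal_add hq (by linarith)]
  simp

theorem integral_coin {E : Type*} [NormedAddCommGroup E] [NormedSpace ℝ E] [CompleteSpace E]
    {q : ℝ} (hq : 0 ≤ q) (hq1 : q ≤ 1) (f : Bool → E) :
    ∫ s, f s ∂(coin q) = q • f true + (1 - q) • f false := by
  rw [coin, integral_add_measure, integral_smul_measure, integral_smul_measure, integral_dirac,
    integral_dirac, ENNReal.toReal_ofReal hq, ENNReal.toReal_ofReal (by linarith)]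
  · exact (Integrable.of_finite (μ := Measure.dirac true)).smul_measure ENNReal.ofReal_ne_top
  · exact (Integrable.of_finite (μ := Measure.dirac false)).smul_measure ENNReal.ofReal_ne_top

variable {H : Type*} [NormedAddCommGroup H] [InnerProductSpace ℝ H] [CompleteSpace H]
  [MeasurableSpace H] [BorelSpace H] [SecondCountableTopology H]

/-- An oracle that returns the second summand of `a x + M₀ • v x` only with probability `q`. -/
theorem isStochasticOracle_coin {T : H → Set H} {a v : H → H} {q M₀ σ : ℝ} (hq : 0 < q)
    (hq1 : q ≤ 1) (ha : Measurable a) (hv : Measurable v) (hv1 : ∀ x, ‖v x‖ ≤ 1)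
    (hT : ∀ x, a x + M₀ • v x ∈ T x) (hσ : M₀ ^ 2 * (1 - q) ≤ σ ^ 2 * q) :
    IsStochasticOracle T (coin q) σ fun x s => a x + (if s = true then M₀ / q else 0) • v x := by
  have := isProbabilityMeasure_coin hq.le hq1
  have mean : ∀ x, ∫ s, (a x + (if s = true then M₀ / q else 0) • v x) ∂(coin q) =
      a x + M₀ • v x := fun x => by
    rw [integral_coin hq.le hq1]
    simp only [if_true, Bool.false_eq_true, if_false]
    have e : M₀ = q * (M₀ / q) := by field_simp
    nth_rw 2 [e]
    module
  refine ⟨?_, fun x => ?_, fun x => ?_, fun x => ?_⟩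
  · refine (ha.comp measurable_fst).add (Measurable.smul ?_ (hv.comp measurable_fst))
    exact (measurable_of_finite fun s : Bool => if s = true then M₀ / q else 0).comp measurable_snd
  · exact MemLp.of_discrete
  · rw [mean]
    exact hT x
  · rw [mean, integral_coin hq.le hq1]
    simp only [if_true, Bool.false_eq_true, if_false, add_sub_add_left_eq_sub, ← sub_smul,
      norm_smul, mul_pow, smul_eq_mul, Real.norm_eq_abs, sq_abs]
    have h1 : ‖v x‖ ^ 2 ≤ 1 := pow_le_one₀ (norm_nonneg _) (hv1 x)
    have e : q * ((M₀ / q - M₀) ^ 2 * ‖v x‖ ^ 2) + (1 - q) * ((0 - M₀) ^ 2 * ‖v x‖ ^ 2) =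
        M₀ ^ 2 * (1 - q) / q * ‖v x‖ ^ 2 := by
      field_simp
      ring
    rw [e]
    have h2 : M₀ ^ 2 * (1 - q) / q ≤ σ ^ 2 := (div_le_iff₀ hq).2 hσ
    have h3 : 0 ≤ M₀ ^ 2 * (1 - q) / q :=
      div_nonneg (mul_nonneg (sq_nonneg _) (by linarith)) hq.le
    nlinarith

end Oracle

/-! ## Lower bounds for the runs of the algorithm -/

section Lower

variable {m N₁ N₂ : ℕ} {H : Type*} [NormedAddCommGroup H] [InnerProductSpace ℝ H]

/-- The subspaces do not depend on the inner index: oracle calls are free here and only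
communications count. The map `π` lets the same bound serve saddle points. -/
theorem output_mem_vanishing_chain (π : H →ₗ[ℝ] EuclideanSpace ℝ (Fin (N₁ + N₂)))
    {lam : ℝ} {w : Bool → ℝ} (hN₂ : 0 < N₂) {g : Fin (m * 3) → H → Bool → H}
    (hg : ∀ i x s, π (g i x s) = hardGrad N₁ N₂ lam (w s) (i % 3) (π x))
    {W : ℕ → Matrix (Fin (m * 3)) (Fin (m * 3)) ℝ} (hm : 0 < m)
    (hW : ∀ k (i j : Fin (m * 3)), i ≠ j → W k i j ≠ 0 → level m k j ≤ level m (k + 1) i)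
    {r : ℝ} (p : Params r) (K T : ℕ) (s : ℕ → ℕ → Bool) :
    π (output p g K T W s) ∈ vanishing (N₁ + N₂) (K / m + 1) N₁ := by
  refine output_mem p g K T W s (fun k _ i => (vanishing _ (level m k i) N₁).comap π)
    (fun k i => monotone_const) (fun k i => ?_) (fun k t i x hx => ?_) (fun k i j hij h => ?_)
    ((vanishing _ (K / m + 1) N₁).comap π) fun i => ?_
  · exact Submodule.comap_mono (vanishing_mono _ (level_mono m i (Nat.le_succ k)))
  · rw [Submodule.mem_comap, hg]
    exact add_mem
      (Submodule.smul_mem _ _ (chainPartGrad_mem_vanishing_level (level_mod_two_ne m k i) hx))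
      (Submodule.smul_mem _ _ (maxGrad_mem_vanishing_of_le hN₂ le_rfl _))
  · exact Submodule.comap_mono (vanishing_mono _ (hW k i j hij h))
  · exact Submodule.comap_mono (vanishing_mono _ (level_le hm K i))

theorem output_mem_vanishing_max (π : H →ₗ[ℝ] EuclideanSpace ℝ (Fin (N₁ + N₂)))
    {lam : ℝ} {w : Bool → ℝ} (hw : w false = 0) (hN₂ : 0 < N₂)
    {g : Fin (m * 3) → H → Bool → H}
    (hg : ∀ i x s, π (g i x s) = hardGrad N₁ N₂ lam (w s) (i % 3) (π x))
    (W : ℕ → Matrix (Fin (m * 3)) (Fin (m * 3)) ℝ)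
    {r : ℝ} (p : Params r) (K T : ℕ) (s : ℕ → ℕ → Bool) :
    π (output p g K T W s) ∈ vanishing (N₁ + N₂)
      (N₁ + ∑ k ∈ Finset.range K, ∑ t ∈ Finset.range T, (s k t).toNat) (N₁ + N₂) := by
  -- Number of heads before inner step `t` of iteration `k`. The subspaces are the same for all
  -- nodes, so gossip costs nothing here, whereas each head releases one coordinate.
  let c : ℕ → ℕ → ℕ := fun k t => ∑ k' ∈ Finset.range k, ∑ t' ∈ Finset.range T, (s k' t').toNat +
    ∑ t' ∈ Finset.range t, (s k t').toNat
  have hc : ∀ k t, c k (t + 1) = c k t + (s k t).toNat := fun k t => by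
    simp only [c, Finset.sum_range_succ, add_assoc]
  have hc' : ∀ k, c k T = c (k + 1) 0 := fun k => by
    simp only [c, Finset.sum_range_succ, Finset.range_zero, Finset.sum_empty, add_zero]
  have hmono : ∀ k, Monotone (c k) := fun k =>
    monotone_nat_of_le_succ fun t => by rw [hc]; exact Nat.le_add_right _ _
  refine output_mem p g K T W s
    (fun k t _ => (vanishing _ (N₁ + c k t) (N₁ + N₂)).comap π)
    (fun k i t t' h => ?_) (fun k i => ?_) (fun k t i x hx => ?_) (fun k i j _ _ => ?_)
    ((vanishing _ (N₁ + ∑ k ∈ Finset.range K, ∑ t ∈ Finset.range T, (s k t).toNat)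
      (N₁ + N₂)).comap π) fun i => ?_
  · exact Submodule.comap_mono (vanishing_mono _ (Nat.add_le_add_left (hmono k h) _))
  · rw [hc']
  · rw [Submodule.mem_comap, hg]
    refine add_mem (Submodule.smul_mem _ _
      (chainPartGrad_mem_vanishing_of_le _ _ (Nat.le_add_right _ _) _)) ?_
    cases hs : s k t with
    | false => rw [hw, zero_smul]; exact zero_mem _
    | true =>
      rw [hc, hs]
      exact Submodule.smul_mem _ _ (maxGrad_mem_vanishing_succ hN₂ hx)
  · exact Submodule.comap_mono (vanishing_mono _
      (Nat.add_le_add_left ((hmono k (Nat.zero_le T)).trans (hc' k).le) _))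
  · simp only [c, Finset.range_zero, Finset.sum_empty, add_zero]
    exact le_rfl

theorem requiresAtLeast_of_gap (π : H →ₗ[ℝ] EuclideanSpace ℝ (Fin (N₁ + N₂)))
    {lam q r ε D₁ D₂ : ℝ} {w : Bool → ℝ} (hw : w false = 0) (hm : 0 < m) (hN₂ : 0 < N₂)
    (hq : 0 < q) (hq1 : q ≤ 1) {g : Fin (m * 3) → H → Bool → H}
    (hg : ∀ i x s, π (g i x s) = hardGrad N₁ N₂ lam (w s) (i % 3) (π x))
    {N : Network (m * 3)} {commTime : ℕ → ℝ≥0}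
    (hN : ∀ k (i j : Fin (m * 3)), i ≠ j → N.W (commTime k) i j ≠ 0 →
      level m k j ≤ level m (k + 1) i)
    {gap : H → ℝ} (gap_nonneg : ∀ x, 0 ≤ gap x)
    (gap_chain : ∀ x, ∀ l < N₁, π x ∈ vanishing (N₁ + N₂) l N₁ → D₁ ≤ gap x)
    (gap_max : ∀ x, ∀ l < N₂, π x ∈ vanishing (N₁ + N₂) (N₁ + l) (N₁ + N₂) → D₂ ≤ gap x)
    (hD₁ : ε < D₁) (hD₂ : 2 * ε < D₂) (hD : 0 < D₂) :
    RequiresAtLeast r gap N commTime (coin q) g ε (m * (N₁ - 1)) (N₂ / (2 * q)) := by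
  intro Ω _ μ _ s hs hmap _ p K T _ _ hint hle
  constructor
  · by_contra! hK
    -- Some chain coordinate is then still zero for every outcome of the coins, so the gap is at
    -- least `D₁ > ε` surely.
    have hlt : K / m + 1 < N₁ := by
      by_contra! h
      have h1 : m * (N₁ - 1) ≤ K :=
        (Nat.mul_le_mul_left m (Nat.sub_le_iff_le_add.2 h)).trans (Nat.mul_div_le K m)
      have h2 : (m : ℝ) * (N₁ - 1) ≤ m * ((N₁ - 1 : ℕ) : ℝ) := by
        refine mul_le_mul_of_nonneg_left ?_ (Nat.cast_nonneg m)
        rw [sub_le_iff_le_add]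
        exact_mod_cast le_tsub_add
      have h3 : (m : ℝ) * ((N₁ - 1 : ℕ) : ℝ) ≤ K := by exact_mod_cast h1
      linarith
    have h := integral_mono (integrable_const D₁) hint fun ω =>
      gap_chain _ _ hlt (output_mem_vanishing_chain π hN₂ hg hm hN p K T fun k t => s k t ω)
    simp only [integral_const, probReal_univ, one_smul] at h
    linarith
  · by_contra! hKT
    have hN₂' : (0 : ℝ) < N₂ := by exact_mod_cast hN₂
    let S : Ω → ℝ := fun ω => ∑ k ∈ Finset.range K, ∑ t ∈ Finset.range T, ((s k t ω).toNat : ℝ)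
    have hmeas : ∀ k t, Measurable fun ω => ((s k t ω).toNat : ℝ) := fun k t =>
      (measurable_of_finite fun b : Bool => (b.toNat : ℝ)).comp (hs k t)
    have hi : ∀ k t, Integrable (fun ω => ((s k t ω).toNat : ℝ)) μ := fun k t =>
      Integrable.of_bound (hmeas k t).aestronglyMeasurable 1 (Filter.Eventually.of_forall
        fun ω => by cases s k t ω <;> simp)
    have hmean : ∀ k t, ∫ ω, ((s k t ω).toNat : ℝ) ∂μ = q := fun k t => by
      have h := integral_map (hs k t).aemeasurable
        (measurable_of_finite fun b : Bool => (b.toNat : ℝ)).aestronglyMeasurable (μ := μ)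
      rw [← h, hmap, integral_coin hq.le hq1]
      simp
    have hSi : Integrable S μ :=
      integrable_finsetSum _ fun k _ => integrable_finsetSum _ fun t _ => hi k t
    have hS : ∫ ω, S ω ∂μ = K * T * q := by
      simp only [S]
      rw [integral_finsetSum _ fun k _ => integrable_finsetSum _ fun t _ => hi k t]
      simp_rw [integral_finsetSum _ fun t (_ : t ∈ Finset.range T) => hi _ t, hmean]
      simp [mul_assoc]
    -- Fewer than `N₂` heads leave a gap of `D₂`; otherwise the left side is nonpositive. The bound
    -- is affine in the number of heads `S`, so only its mean `K * T * q < N₂ / 2` enters, and the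
    -- expected gap is at least `D₂ / 2 > ε`.
    have hbound : ∀ ω, D₂ - D₂ / N₂ * S ω ≤
        gap (output p g K T (fun k => N.W (commTime k)) fun k t => s k t ω) := fun ω => by
      by_cases h : ∑ k ∈ Finset.range K, ∑ t ∈ Finset.range T, (s k t ω).toNat < N₂
      · refine le_trans ?_ (gap_max _ _ h (output_mem_vanishing_max π hw hN₂ hg _ p K T _))
        have : 0 ≤ S ω := Finset.sum_nonneg fun _ _ => Finset.sum_nonneg fun _ _ => by positivity
        have : 0 ≤ D₂ / N₂ * S ω := by positivity
        linarith
      · refine le_trans ?_ (gap_nonneg _)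
        have h1 : (N₂ : ℝ) ≤ S ω := by
          simp only [S]
          exact_mod_cast not_lt.1 h
        have h2 := mul_le_mul_of_nonneg_left h1 (div_nonneg hD.le hN₂'.le)
        rw [div_mul_cancel₀ _ hN₂'.ne'] at h2
        linarith
    have h : ∫ ω, (D₂ - D₂ / N₂ * S ω) ∂μ ≤ _ :=
      integral_mono ((integrable_const D₂).sub (hSi.const_mul (D₂ / N₂))) hint hbound
    rw [integral_sub (integrable_const _) (hSi.const_mul _), integral_const_mul, hS] at h
    simp only [integral_const, probReal_univ, one_smul] at h
    rw [lt_div_iff₀ (by positivity)] at hKT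
    have h1 : D₂ / N₂ * (K * T * q) ≤ D₂ / 2 := by
      rw [div_mul_eq_mul_div, div_le_div_iff₀ hN₂' two_pos]
      nlinarith
    linarith

end Lower

/-! ## Minimization problems as saddle point problems -/

/-- The saddle point problem of a minimization problem: its functions do not depend on `ζ`. -/
def ConvexProblem.toSaddle {n d : ℕ} (P : ConvexProblem n d) (d₂ : ℕ) : SaddleProblem n d d₂ where
  f i ξ _ := P.f i ξ
  convex i _ := P.convex i
  concave _ _ := concaveOn_const _ convex_univ

section Saddle

variable {n d d₂ : ℕ} (P : ConvexProblem n d)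

theorem ConvexProblem.gap_toSaddle (r : ℝ) (xs : EuclideanSpace ℝ (Fin d))
    (x : PairSpace d d₂) :
    (P.toSaddle d₂).gap r (WithLp.toLp 2 (xs, 0)) x = P.gap r xs x.fst + r / 2 * ‖x.snd‖ ^ 2 := by
  simp only [SaddleProblem.gap, SaddleProblem.objective, toSaddle, ConvexProblem.gap,
    ConvexProblem.objective, WithLp.toLp_fst, WithLp.toLp_snd, norm_zero]
  ring

theorem ConvexProblem.isSolution_toSaddle {r : ℝ} (hr : 0 ≤ r) {xs : EuclideanSpace ℝ (Fin d)}
    (h : P.IsSolution r xs) : (P.toSaddle d₂).IsSolution r (WithLp.toLp 2 (xs, 0)) := by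
  intro ξ ζ
  have h1 := h ξ
  have h2 : 0 ≤ r / 2 * ‖ζ‖ ^ 2 := by positivity
  simp only [SaddleProblem.objective, toSaddle, ConvexProblem.objective, WithLp.toLp_fst,
    WithLp.toLp_snd, norm_zero] at h1 ⊢
  constructor <;> linarith

theorem subdiff_const {E : Type*} [NormedAddCommGroup E] [InnerProductSpace ℝ E] (a : ℝ) (x : E) :
    subdiff (fun _ => a) x = {0} := by
  ext g
  constructor
  · intro h
    have h1 := h (x + g)
    rw [add_sub_cancel_left, real_inner_self_eq_norm_sq] at h1
    exact norm_eq_zero.1 (by nlinarith [norm_nonneg g])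
  · rintro rfl y
    simp

theorem ConvexProblem.mem_operator_toSaddle {i : Fin n} {x g : PairSpace d d₂} :
    g ∈ (P.toSaddle d₂).operator i x ↔ g.fst ∈ P.operator i x.fst ∧ g.snd = 0 := by
  simp only [SaddleProblem.operator, toSaddle, Set.mem_ofPred_eq, subdiff_const,
    Set.mem_singleton_iff, ConvexProblem.operator]

theorem ConvexProblem.operatorBound_toSaddle {M : ℝ} (h : OperatorBound P.operator M) :
    OperatorBound (P.toSaddle d₂).operator M := by
  intro i x g hg
  obtain ⟨h1, h2⟩ := P.mem_operator_toSaddle.1 hg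
  have e : ‖g‖ ^ 2 = ‖g.fst‖ ^ 2 := by
    rw [WithLp.prod_norm_sq_eq_of_L2, h2, norm_zero]
    ring
  rw [(sq_eq_sq₀ (norm_nonneg _) (norm_nonneg _)).1 e]
  exact h i _ _ h1

end Saddle

/-! ## Choice of the constants -/

/-- The threshold `72` is where `X / 18 - 2 ≥ X / 36`: one unit is lost to the floor, one to the `N₁
- 1` of the communication bound. -/
theorem exists_chain_length {X : ℝ} (hX : 72 ≤ X) :
    ∃ N : ℕ, 0 < N ∧ (N : ℝ) ≤ X / 18 ∧ X / 36 ≤ (N : ℝ) - 1 := by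
  have h1 : (⌊X / 18⌋₊ : ℝ) ≤ X / 18 := Nat.floor_le (by linarith)
  have h2 : X / 18 < ⌊X / 18⌋₊ + 1 := Nat.lt_floor_add_one _
  exact ⟨⌊X / 18⌋₊, Nat.floor_pos.2 (by linarith), h1, by linarith⟩

theorem exists_max_length {X : ℝ} (hX : 72 ≤ X) :
    ∃ N : ℕ, 0 < N ∧ (N : ℝ) ≤ X ^ 2 / 32 ∧ X ^ 2 / 64 ≤ N := by
  have h0 : 72 ^ 2 ≤ X ^ 2 := pow_le_pow_left₀ (by norm_num) hX 2
  have h1 : (⌊X ^ 2 / 32⌋₊ : ℝ) ≤ X ^ 2 / 32 := Nat.floor_le (by positivity)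
  have h2 : X ^ 2 / 32 < ⌊X ^ 2 / 32⌋₊ + 1 := Nat.lt_floor_add_one _
  exact ⟨⌊X ^ 2 / 32⌋₊, Nat.floor_pos.2 (by linarith), h1, by linarith⟩

theorem RequiresAtLeast.mono {n : ℕ} {H Ξ : Type*} [NormedAddCommGroup H] [InnerProductSpace ℝ H]
    [MeasurableSpace Ξ] {r : ℝ} {gap : H → ℝ} {N : Network n} {commTime : ℕ → ℝ≥0}
    {ν : Measure Ξ} {g : Fin n → H → Ξ → H} {ε a b a' b' : ℝ}
    (h : RequiresAtLeast r gap N commTime ν g ε a b) (ha : a' ≤ a) (hb : b' ≤ b) :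
    RequiresAtLeast r gap N commTime ν g ε a' b' :=
  fun Ω _ μ _ s h1 h2 h3 p K T hK hT h4 h5 =>
    have h6 := h Ω μ s h1 h2 h3 p K T hK hT h4 h5
    ⟨ha.trans h6.1, hb.trans h6.2⟩

theorem lower_bound_constants {r M σ χ ε X q : ℝ} {m N₁ N₂ : ℕ} (hr : 0 < r) (hM : 0 < M) (hε : 0 < ε)
    (hX0 : 0 < X) (hX : M = X * √(r * ε)) (hχ : 1 ≤ χ) (hm : χ / 6 ≤ m) (hN₁ : 0 < N₁)
    (hN₂ : 0 < N₂) (hN₁le : (N₁ : ℝ) ≤ X / 18) (hN₁ge : X / 36 ≤ (N₁ : ℝ) - 1)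
    (hN₂le : (N₂ : ℝ) ≤ X ^ 2 / 32) (hN₂ge : X ^ 2 / 64 ≤ N₂)
    (hq : q = (M / 2) ^ 2 / ((M / 2) ^ 2 + σ ^ 2)) :
    ε < (M / (4 * √N₁) / 3) ^ 2 / (2 * r * N₁) ∧ 2 * ε < (M / 2) ^ 2 / (2 * r * N₂) ∧
      1 / 216 * (χ * M / √(r * ε)) ≤ m * ((N₁ : ℝ) - 1) ∧
      1 / 216 * ((M + σ) ^ 2 / (r * ε)) ≤ N₂ / (2 * q) := by
  have hs : 0 < √(r * ε) := Real.sqrt_pos.2 (by positivity)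
  have hM2 : M ^ 2 = X ^ 2 * (r * ε) := by
    rw [hX, mul_pow, Real.sq_sqrt (by positivity)]
  have h1 : (0 : ℝ) < N₁ := by exact_mod_cast hN₁
  have h2 : (0 : ℝ) < N₂ := by exact_mod_cast hN₂
  have hrε : 0 < r * ε := by positivity
  refine ⟨?_, ?_, ?_, ?_⟩
  -- The required inequality is `288 * N₁ ^ 2 < X ^ 2`, which `N₁ ≤ X / 18` ensures since `18 ^ 2 =
  -- 324`.
  · have e : (M / (4 * √N₁) / 3) ^ 2 / (2 * r * N₁) = M ^ 2 / (288 * r * N₁ ^ 2) := by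
      rw [div_pow, div_pow, mul_pow, Real.sq_sqrt h1.le]
      field_simp
      norm_num
    rw [e, lt_div_iff₀ (by positivity), hM2]
    have h3 : (N₁ : ℝ) ^ 2 ≤ (X / 18) ^ 2 := pow_le_pow_left₀ h1.le hN₁le 2
    have h4 : 288 * (N₁ : ℝ) ^ 2 < X ^ 2 := by nlinarith [sq_pos_of_pos hX0]
    nlinarith
  · rw [lt_div_iff₀ (by positivity), div_pow, hM2]
    nlinarith [sq_pos_of_pos hX0]
  · have e : χ * M / √(r * ε) = χ * X := by
      rw [hX]
      field_simp
    rw [e]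
    refine le_trans (le_of_eq (by ring)) (mul_le_mul hm hN₁ge (by positivity) (by positivity))
  · have hq0 : 0 < q := by rw [hq]; positivity
    have e : (N₂ : ℝ) / (2 * q) = N₂ * ((M / 2) ^ 2 + σ ^ 2) * 2 / M ^ 2 := by
      rw [hq]
      field_simp
    -- Cauchy–Schwarz for `M + σ = 2 * (M / 2) + 1 * σ`. The resulting constant `1 / 160` is better
    -- than `1 / 216`.
    have h3 : (M + σ) ^ 2 ≤ 5 * ((M / 2) ^ 2 + σ ^ 2) := by nlinarith [sq_nonneg (M / 2 - 2 * σ)]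
    have h4 : X ^ 2 / 64 * ((M / 2) ^ 2 + σ ^ 2) * 2 / M ^ 2 ≤ N₂ / (2 * q) := by
      rw [e]
      gcongr
    refine le_trans ?_ h4
    have e2 : X ^ 2 / 64 * ((M / 2) ^ 2 + σ ^ 2) * 2 / M ^ 2 =
        1 / 32 * ((M / 2) ^ 2 + σ ^ 2) / (r * ε) := by
      rw [hM2]
      field_simp
      norm_num
    rw [e2, ← mul_div_assoc]
    refine div_le_div_of_nonneg_right ?_ hrε.le
    nlinarith [sq_nonneg M, sq_nonneg σ]

end

end Decentralized

/-! ### One instance for minimization and its saddle point version -/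

open Decentralized in
theorem mainTheorem4 :
    ∃ c > (0 : ℝ), ∃ c₀ > (0 : ℝ),
      ∀ r M σ χ ε : ℝ, 0 < r → 0 < M → 0 ≤ σ → 1 ≤ χ → 0 < ε → ε ≤ c₀ * M ^ 2 / r →
      ∀ commTime : ℕ → ℝ≥0, StrictMono commTime →
        -- a hard convex minimization problem
        (∃ (n d : ℕ) (P : Decentralized.ConvexProblem n d) (N : Decentralized.Network n)
            (xs : EuclideanSpace ℝ (Fin d)) (Ξ : Type) (_ : MeasurableSpace Ξ) (ν : Measure Ξ)
            (g : Fin n → EuclideanSpace ℝ (Fin d) → Ξ → EuclideanSpace ℝ (Fin d)),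
          0 < n ∧ 0 < d ∧ IsProbabilityMeasure ν ∧
          Decentralized.OperatorBound P.operator M ∧
          (∀ i, Decentralized.IsStochasticOracle (P.operator i) ν σ (g i)) ∧
          N.HasConditionNumber χ ∧
          P.IsSolution r xs ∧
          Decentralized.RequiresAtLeast r (P.gap r xs) N commTime ν g ε
            (c * (χ * M / √(r * ε))) (c * ((M + σ) ^ 2 / (r * ε)))) ∧
        -- a hard saddle point problem
        (∃ (n d₁ d₂ : ℕ) (P : Decentralized.SaddleProblem n d₁ d₂) (N : Decentralized.Network n)
            (xs : Decentralized.PairSpace d₁ d₂) (Ξ : Type) (_ : MeasurableSpace Ξ)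
            (ν : Measure Ξ)
            (g : Fin n → Decentralized.PairSpace d₁ d₂ → Ξ → Decentralized.PairSpace d₁ d₂),
          0 < n ∧ 0 < d₁ ∧ 0 < d₂ ∧ IsProbabilityMeasure ν ∧
          Decentralized.OperatorBound P.operator M ∧
          (∀ i, Decentralized.IsStochasticOracle (P.operator i) ν σ (g i)) ∧
          N.HasConditionNumber χ ∧
          P.IsSolution r xs ∧
          Decentralized.RequiresAtLeast r (P.gap r xs) N commTime ν g ε
            (c * (χ * M / √(r * ε))) (c * ((M + σ) ^ 2 / (r * ε)))) := by
  -- `216 = 6 * 36` combines the losses in `m ≥ χ / 6` and `N₁ - 1 ≥ X / 36`; the second constant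
  -- says `X = M / √(r * ε) ≥ 72`.
  refine ⟨1 / 216, by norm_num, 1 / 72 ^ 2, by norm_num, ?_⟩
  intro r M σ χ ε hr hM hσ hχ hε hεM commTime hc
  have hs : 0 < √(r * ε) := Real.sqrt_pos.2 (by positivity)
  have hX : 72 ≤ M / √(r * ε) := by
    rw [le_div_iff₀ hs]
    refine abs_le_of_sq_le_sq' ?_ hM.le |>.2
    rw [mul_pow, Real.sq_sqrt (by positivity)]
    rw [le_div_iff₀ hr] at hεM
    linarith
  have hMX : M = M / √(r * ε) * √(r * ε) := by field_simp
  set X := M / √(r * ε)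
  obtain ⟨N₁, hN₁, hN₁le, hN₁ge⟩ := exists_chain_length hX
  obtain ⟨N₂, hN₂, hN₂le, hN₂ge⟩ := exists_max_length hX
  obtain ⟨m, N, hm, hmχ, hNχ, hN⟩ := exists_network hχ hc.injective
  -- The smallest probability the variance bound allows: `M₀² * (1 - q) / q = σ²` with `M₀ = M / 2`.
  set q := (M / 2) ^ 2 / ((M / 2) ^ 2 + σ ^ 2) with hq_def
  have hden : 0 < (M / 2) ^ 2 + σ ^ 2 := by positivity
  have hq : 0 < q := by positivity
  have hq1 : q ≤ 1 := (div_le_one hden).2 (by linarith [sq_nonneg σ])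
  have hσq : (M / 2) ^ 2 * (1 - q) ≤ σ ^ 2 * q := by
    refine le_of_eq ?_
    rw [hq_def]
    field_simp
    ring
  obtain ⟨hD₁, hD₂, hNcomm, hNoracle⟩ := lower_bound_constants hr hM hε (by linarith) hMX hχ
    hmχ hN₁ hN₂ hN₁le hN₁ge hN₂le hN₂ge hq_def
  -- The bound `M` on subgradients is split evenly: `lam * 2 * √N₁ = M / 2` for the chain and `M /
  -- 2` for the maximum.
  set lam := M / (4 * √N₁) with hlam_def
  have hN₁' : (0 : ℝ) < N₁ := by exact_mod_cast hN₁
  have hlam : 0 ≤ lam := by positivity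
  have hM₀ : 0 ≤ M / 2 := by positivity
  have hL : lam * (2 * √N₁) + M / 2 = M := by
    have := Real.sqrt_pos.2 hN₁'
    rw [hlam_def]
    field_simp
    ring
  set P := hardProblem m N₁ N₂ lam (M / 2) hN₂ hlam hM₀
  have hP : OperatorBound P.operator M := fun i x g hg =>
    (norm_le_of_mem_subdiff_hardFn hN₂ hlam hM₀ hg).trans hL.le
  have hsol : P.IsSolution r (hardSol N₁ N₂ r lam (M / 2)) :=
    isSolution_hardSol hm hN₁ hN₂ hlam hM₀ hr
  have hgap := hardGap_ge hm hN₁ hN₂ hlam hM₀ hr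
  have hmem : ∀ (i : Fin (m * 3)) x, hardGrad N₁ N₂ lam (M / 2) (i % 3) x ∈ P.operator i x :=
    fun i x => hardGrad_mem hN₂ hlam hM₀ _ x
  have hD : 0 < (M / 2) ^ 2 / (2 * r * N₂) := by linarith
  have hmeasChain : ∀ b, Measurable fun x : EuclideanSpace ℝ (Fin (N₁ + N₂)) =>
      lam • chainPartGrad N₁ b x := fun b =>
    (Finset.measurable_fun_sum _ fun e _ => measurable_chainLinkGrad e).const_smul lam
  refine ⟨⟨m * 3, N₁ + N₂, P, N, _, Bool, inferInstance, coin q,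
    fun i x s => hardGrad N₁ N₂ lam (if s = true then M / 2 / q else 0) (i % 3) x,
    by omega, by omega, isProbabilityMeasure_coin hq.le hq1, hP, fun i => ?_, hNχ, hsol, ?_⟩,
    ⟨m * 3, N₁ + N₂, 1, P.toSaddle 1, N, _, Bool, inferInstance, coin q,
    fun i x s => WithLp.toLp 2
      (hardGrad N₁ N₂ lam (if s = true then M / 2 / q else 0) (i % 3) x.fst, 0),
    by omega, by omega, one_pos, isProbabilityMeasure_coin hq.le hq1,
    P.operatorBound_toSaddle hP, fun i => ?_, hNχ, P.isSolution_toSaddle hr.le hsol, ?_⟩⟩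
  · exact isStochasticOracle_coin hq hq1 (hmeasChain _) (measurable_maxGrad N₁ N₂)
      (norm_maxGrad_le N₁ hN₂) (hmem i) hσq
  · exact (requiresAtLeast_of_gap LinearMap.id (w := fun s => if s = true then M / 2 / q else 0)
      (by simp) hm hN₂ hq hq1 (fun _ _ _ => rfl) hN (fun x => (hgap x).1)
      (fun x => (hgap x).2.1) (fun x => (hgap x).2.2) hD₁ hD₂ hD).mono hNcomm hNoracle
  · have hfst : Measurable (WithLp.fst : PairSpace (N₁ + N₂) 1 → _) :=
      (WithLp.fstL 2 ℝ _ _).continuous.measurable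
    have hι : Measurable fun x : EuclideanSpace ℝ (Fin (N₁ + N₂)) =>
        (WithLp.toLp 2 (x, 0) : PairSpace (N₁ + N₂) 1) :=
      (WithLp.measurable_toLp 2 _).comp (measurable_id.prodMk measurable_const)
    have h := isStochasticOracle_coin (T := (P.toSaddle 1).operator i) (M₀ := M / 2) (σ := σ)
      (a := fun x => WithLp.toLp 2 (lam • chainPartGrad N₁ (i % 3) x.fst, 0))
      (v := fun x => WithLp.toLp 2 (maxGrad N₁ N₂ x.fst, 0)) hq hq1
      (hι.comp ((hmeasChain _).comp hfst)) (hι.comp ((measurable_maxGrad N₁ N₂).comp hfst))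
      (fun x => by rw [WithLp.norm_toLp_fst]; exact norm_maxGrad_le N₁ hN₂ _)
      (fun x => P.mem_operator_toSaddle.2 ⟨hmem i _, by simp⟩) hσq
    convert h using 3 with x s
    refine WithLp.ofLp_injective 2 (Prod.ext rfl ?_)
    exact ((zero_add _).trans (smul_zero _)).symm
  -- The saddle gap is the minimization gap of `ξ` plus `r / 2 * ‖ζ‖²`, so the lower bounds on the
  -- gap carry over through the projection to `ξ`.
  · have hle : ∀ x, P.gap r (hardSol N₁ N₂ r lam (M / 2)) x.fst ≤ (P.toSaddle 1).gap r
        (WithLp.toLp 2 (hardSol N₁ N₂ r lam (M / 2), 0)) x := fun x => by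
      rw [P.gap_toSaddle]
      have : 0 ≤ r / 2 * ‖x.snd‖ ^ 2 := by positivity
      linarith
    let π : PairSpace (N₁ + N₂) 1 →ₗ[ℝ] EuclideanSpace ℝ (Fin (N₁ + N₂)) := WithLp.fstₗ 2 ℝ _ _
    have hπ : ∀ x, π x = x.fst := fun _ => rfl
    refine (requiresAtLeast_of_gap π (lam := lam) (w := fun s => if s = true then M / 2 / q else 0)
      (by simp) hm hN₂ hq hq1 (fun i x s => ?_) hN (fun x => (hgap x.fst).1.trans (hle x))
      (fun x l hl hx => ?_) (fun x l hl hx => ?_) hD₁ hD₂ hD).mono hNcomm hNoracle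
    · rw [hπ, hπ, WithLp.toLp_fst]
    · rw [hπ] at hx
      exact ((hgap x.fst).2.1 l hl hx).trans (hle x)
    · rw [hπ] at hx
      exact ((hgap x.fst).2.2 l hl hx).trans (hle x)
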